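/- **Conventions.** $2^{\mathbb N}$ is Cantor space, $[\![\sigma]\!]$ is the set of sequences extending the finite binary string $\sigma$, and a $\Pi^0_1$ class is the complement in $2^{\mathbb N}$ of $\bigcup_{\sigma\in S}[\![\sigma]\!]$ for some c.e. set $S$ of strings (the empty class is allowed). A finite Borel measure $\mu$ on $2^{\mathbb N}$ is *computable* if there is a computable map $(\sigma,i)\mapsto q(\sigma,i)$ into the dyadic rationals with $|\mu([\![\sigma]\!])-q(\sigma,i)|\le 2^{-i}$ for all $\sigma,i$. A class $\mathcal C$ is *tt-negligible* if $\mu(\mathcal C)=0$ for every computable measure $\mu$. A $\Pi^0_1$ class $\mathcal C$ is *tt-deep* if for every computable measure $\mu$ there is a computable, non-decreasing, unbounded function $h:\mathbb N\to\mathbb N$ such that $\sum_{\sigma\in T_n}\mu([\![\sigma]\!])<2^{-h(n)}$ for all sufficiently large $n$, where $T_n$ is the set of strings of length $n$ that have an extension in $\mathcal C$. A *Turing functional* $\Phi$ is a c.e. set of pairs of strings such that whenever $(\sigma,\tau),(\sigma',\tau')\in\Phi$ and $\sigma$ is a prefix of $\sigma'$, the strings $\tau,\tau'$ are comparable; $X\in\mathrm{dom}(\Phi)$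 if the strings $\tau$ with $(\sigma,\tau)\in\Phi$ for some prefix $\sigma$ of $X$ are of unbounded length, and then $\Phi(X)$ is the sequence extending all of them. For $\Pi^0_1$ classes, $\mathcal C\le_w\mathcal D$ (Muchnik reducibility) means that for every $X\in\mathcal D$ there is a Turing functional $\Phi$ with $X\in\mathrm{dom}(\Phi)$ and $\Phi(X)\in\mathcal C$; $\mathcal C\le_s\mathcal D$ (Medvedev reducibility) means that there is a single Turing functional $\Phi$ with $\mathcal D\subseteq\mathrm{dom}(\Phi)$ and $\Phi(\mathcal D)\subseteq\mathcal C$. The degrees of $\Pi^0_1$ classes under the induced equivalence relations $\equiv_s$, $\equiv_w$ form the lattices $\mathcal E_s$ and $\mathcal E_w$; in both of them the meet and the join of the degrees of $\mathcal C$ and $\mathcal D$ are the degrees of $\{0^\frown X: X\in\mathcal C\}\cup\{1^\frown Y:Y\in\mathcal D\}$ and of $\{X\oplus Y: X\in\mathcal C,\ Y\in\mathcal D\}$, respectively. A *filter* in a lattice is a nonempty subset that is closed upwards and closed under binary meets. **Theorem.** A $\Pi^0_1$ class is tt-deep if and only if it is tt-negligible. For $\Pi^0_1$ classes, tt-depth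 is invariant under $\equiv_s$ and under $\equiv_w$, and the degrees of the tt-deep $\Pi^0_1$ classes form a filter in $\mathcal E_s$ and a filter in $\mathcal E_w$. -/

import Mathlib

open Set Filter MeasureTheory
open scoped ENNReal

namespace MassProblems

/-! ### Cantor space, strings, cylinders -/

/-- Cantor space `2^ℕ`; finite binary strings are `List Bool`. -/
abbrev Cantor : Type := ℕ → Bool

/-- `X ↾ n`, the string of the first `n` bits of `X`. -/
def restr (X : Cantor) (n : ℕ) : List Bool := (List.range n).map X

/-- The cylinder `⟦σ⟧` of all sequences with prefix `σ`. -/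
def cylinder (σ : List Bool) : Set Cantor := {X | restr X σ.length = σ}

/-- Effectively open classes: unions of the cylinders over a c.e. set of strings. -/
def IsSigma01 (U : Set Cantor) : Prop :=
  ∃ S : Set (List Bool), REPred (fun σ => σ ∈ S) ∧ U = ⋃ σ ∈ S, cylinder σ

/-- Effectively closed classes. -/
def IsPi01 (C : Set Cantor) : Prop := IsSigma01 Cᶜ

/-- The type of all `Π⁰₁` classes in Cantor space. -/
structure Pi01Class where
  carrier : Set Cantor
  isPi01 : IsPi01 carrier

/-! ### Computable measures, tt-negligibility, tt-depth -/

/-- A (finite Borel) measure on Cantor space is computable if the dyadic rational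
`num σ i / 2 ^ exp σ i`, computed from `σ` and `i`, approximates `μ ⟦σ⟧` to within `2 ^ (-i)`.
Since `μ ⟦σ⟧ ≥ 0`, natural numerators are no restriction. -/
def IsComputableMeasure (μ : Measure Cantor) : Prop :=
  IsFiniteMeasure μ ∧ ∃ num exp : List Bool → ℕ → ℕ, Computable₂ num ∧ Computable₂ exp ∧
    ∀ σ i, |(μ (cylinder σ)).toReal - (num σ i : ℝ) / 2 ^ exp σ i| ≤ (2 : ℝ)⁻¹ ^ i

/-- `C` is tt-negligible if it is null for every computable measure. -/
def TTNegligible (C : Set Cantor) : Prop :=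
  ∀ μ : Measure Cantor, IsComputableMeasure μ → μ C = 0

/-- The canonical co-c.e. tree of `C`: the strings with an extension in `C`. -/
def canonicalTree (C : Set Cantor) : Set (List Bool) := {σ | (cylinder σ ∩ C).Nonempty}

/-- The `n`-th level of a tree. -/
def treeLevel (T : Set (List Bool)) (n : ℕ) : Set (List Bool) := {σ ∈ T | σ.length = n}

/-- `μ(S) = ∑_{σ ∈ S} μ(⟦σ⟧)` for a set `S` of strings. -/
noncomputable def stringMass (μ : Measure Cantor) (S : Set (List Bool)) : ℝ≥0∞ :=
  ∑' σ : S, μ (cylinder σ)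

/-- A computable order: a computable, non-decreasing, unbounded function. -/
def IsComputableOrder (h : ℕ → ℕ) : Prop :=
  Computable h ∧ Monotone h ∧ ∀ k, ∃ n, k ≤ h n

/-- `C` is tt-deep if for every computable measure `μ` there is a computable order `h` with
`μ(T_n) < 2 ^ (-h n)` for all sufficiently large `n`, where `T` is the canonical tree of `C`. -/
def TTDeep (C : Set Cantor) : Prop :=
  ∀ μ : Measure Cantor, IsComputableMeasure μ → ∃ h : ℕ → ℕ, IsComputableOrder h ∧
    ∀ᶠ n in atTop, stringMass μ (treeLevel (canonicalTree C) n) < (2 : ℝ≥0∞)⁻¹ ^ h n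

/-! ### Turing functionals -/

/-- A Turing functional: a consistent c.e. set of pairs of strings. -/
structure TuringFunctional where
  graph : Set (List Bool × List Bool)
  re : REPred (fun p => p ∈ graph)
  consistent : ∀ σ τ σ' τ', (σ, τ) ∈ graph → (σ', τ') ∈ graph → σ <+: σ' →
    τ <+: τ' ∨ τ' <+: τ

namespace TuringFunctional

/-- The strings that `Φ` outputs on input `X`; they form a chain of prefixes of `Φ^X`. -/
def outputs (Φ : TuringFunctional) (X : Cantor) : Set (List Bool) :=
  {τ | ∃ n, (restr X n, τ) ∈ Φ.graph}

/-- `dom Φ`: the `X` for which `Φ^X` is infinite. -/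
def dom (Φ : TuringFunctional) : Set Cantor :=
  {X | ∀ n, ∃ τ ∈ Φ.outputs X, n ≤ τ.length}

open Classical in
/-- `Φ(X)`, meaningful for `X ∈ dom Φ`: the sequence all of whose prefixes are prefixes of
outputs of `Φ` on `X`. -/
noncomputable def eval (Φ : TuringFunctional) (X : Cantor) : Cantor :=
  fun i => decide (∃ τ ∈ Φ.outputs X, τ[i]? = some true)

end TuringFunctional

/-- Muchnik reducibility `C ≤_w D`. -/
def MuchnikLE (C D : Pi01Class) : Prop :=
  ∀ X ∈ D.carrier, ∃ Φ : TuringFunctional, X ∈ Φ.dom ∧ Φ.eval X ∈ C.carrier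

/-- Medvedev reducibility `C ≤_s D`. -/
def MedvedevLE (C D : Pi01Class) : Prop :=
  ∃ Φ : TuringFunctional, D.carrier ⊆ Φ.dom ∧ Φ.eval '' D.carrier ⊆ C.carrier

/-- `b⌢X`. -/
def consSeq (b : Bool) (X : Cantor) : Cantor := fun n => Nat.casesOn n b X

/-- `X ⊕ Y`, with `(X ⊕ Y)(2n) = X(n)` and `(X ⊕ Y)(2n+1) = Y(n)`. -/
def oplus (X Y : Cantor) : Cantor := fun n => if n % 2 = 0 then X (n / 2) else Y (n / 2)

/-- `{0⌢X : X ∈ C} ∪ {1⌢Y : Y ∈ D}`. -/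
def infSet (C D : Set Cantor) : Set Cantor := consSeq false '' C ∪ consSeq true '' D

/-- `{X ⊕ Y : X ∈ C, Y ∈ D}`. -/
def supSet (C D : Set Cantor) : Set Cantor := {Z | ∃ X ∈ C, ∃ Y ∈ D, Z = oplus X Y}

/-! ### Closure properties of c.e. predicates -/

section RE

variable {α β : Type*} [Primcodable α] [Primcodable β]

theorem re_of_exists {f : α → ℕ → Bool} (hf : Computable₂ f) {p : α → Prop}
    (h : ∀ a, p a ↔ ∃ n, f a n = true) : REPred p := by
  have h1 : Partrec fun a => Nat.rfind fun n => (Part.some (f a n) : Part Bool) :=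
    Partrec.rfind hf.partrec₂
  refine h1.dom_re.of_eq fun a => ?_
  rw [h]
  refine Nat.rfind_dom.trans ?_
  constructor
  · rintro ⟨n, hn, -⟩
    exact ⟨n, by simpa using hn⟩
  · rintro ⟨n, hn⟩
    exact ⟨n, by simpa using hn, fun _ => trivial⟩

theorem exists_of_re {p : α → Prop} (hp : REPred p) :
    ∃ f : α → ℕ → Bool, Computable₂ f ∧ ∀ a, p a ↔ ∃ n, f a n = true := by
  obtain ⟨c, hc⟩ := Nat.Partrec.Code.exists_code.1 hp
  refine ⟨fun a n => (c.evaln n (Encodable.encode a)).isSome, ?_, fun a => ?_⟩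
  · have : Primrec₂ fun (a : α) (n : ℕ) => (c.evaln n (Encodable.encode a)).isSome :=
      Primrec.option_isSome.comp (Nat.Partrec.Code.primrec_evaln.comp
        ((Primrec.snd.pair (Primrec.const c)).pair (Primrec.encode.comp Primrec.fst)))
    exact this.to_comp
  · have h1 : p a ↔ ∃ x, x ∈ c.eval (Encodable.encode a) := by
      rw [hc]
      simp
    rw [h1]
    constructor
    · rintro ⟨x, hx⟩
      obtain ⟨k, hk⟩ := Nat.Partrec.Code.evaln_complete.1 hx
      exact ⟨k, Option.isSome_iff_exists.2 ⟨x, hk⟩⟩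
    · rintro ⟨n, hn⟩
      obtain ⟨x, hx⟩ := Option.isSome_iff_exists.1 hn
      exact ⟨x, Nat.Partrec.Code.evaln_sound hx⟩

theorem re_exists {p : α → β → Prop} (hp : REPred fun q : α × β => p q.1 q.2) :
    REPred fun a => ∃ b, p a b := by
  obtain ⟨f, hf, h⟩ := exists_of_re hp
  let g : α → ℕ → Bool := fun a n =>
    ((Encodable.decode (α := β) n.unpair.1).map fun b => f (a, b) n.unpair.2).getD false
  refine re_of_exists (f := g) ?_ fun a => ?_
  · refine Computable.option_getD (Computable.option_map ?_ ?_) (Computable.const false)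
    · exact Computable.decode.comp
        (Computable.fst.comp (Computable.unpair.comp Computable.snd))
    · exact hf.comp ((Computable.fst.comp Computable.fst).pair Computable.snd)
        (Computable.snd.comp (Computable.unpair.comp (Computable.snd.comp Computable.fst)))
  · constructor
    · rintro ⟨b, hb⟩
      obtain ⟨n, hn⟩ := (h (a, b)).1 hb
      exact ⟨Nat.pair (Encodable.encode b) n, by simpa [g] using hn⟩
    · rintro ⟨n, hn⟩
      cases hd : Encodable.decode (α := β) n.unpair.1 with
      | none => simp [g, hd] at hn
      | some b => exact ⟨b, (h (a, b)).2 ⟨n.unpair.2, by simpa [g, hd] using hn⟩⟩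

theorem re_comp {p : β → Prop} (hp : REPred p) {f : α → β} (hf : Computable f) :
    REPred fun a => p (f a) := Partrec.comp hp hf

theorem re_and {p q : α → Prop} (hp : REPred p) (hq : REPred q) :
    REPred fun a => p a ∧ q a := by
  have : Partrec fun a => (Part.assert (p a) fun _ => Part.some ()).bind
      fun _ => Part.assert (q a) fun _ => Part.some () :=
    Partrec.bind hp (Partrec.comp hq Computable.fst).to₂
  refine this.dom_re.of_eq fun a => ?_
  simp [Part.dom_iff_mem]

theorem re_or {p q : α → Prop} (hp : REPred p) (hq : REPred q) :
    REPred fun a => p a ∨ q a := by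
  obtain ⟨f, hf, h⟩ := exists_of_re hp
  obtain ⟨g, hg, h'⟩ := exists_of_re hq
  refine re_of_exists (f := fun a n => f a n || g a n) ?_ fun a => ?_
  · exact Primrec.or.to_comp.comp hf hg
  · simp [h, h', exists_or]

theorem re_eq {f g : α → List Bool} (hf : Computable f) (hg : Computable g) :
    REPred fun a => f a = g a := by
  have h : REPred fun p : List Bool × List Bool => p.1 = p.2 :=
    (PrimrecPred.computablePred (Primrec.eq (α := List Bool))).to_re
  exact re_comp h (hf.pair hg)

theorem re_prefix {f g : α → List Bool} (hf : Computable f) (hg : Computable g) :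
    REPred fun a => f a <+: g a := by
  have : REPred fun a => ∃ ρ, f a ++ ρ = g a :=
    re_exists (re_eq (Computable.list_append.comp (hf.comp Computable.fst) Computable.snd)
      (hg.comp Computable.fst))
  exact this

end RE

/-! ### Strings -/

@[simp] theorem length_restr (X : Cantor) (n : ℕ) : (restr X n).length = n := by simp [restr]

theorem getElem?_restr (X : Cantor) (n i : ℕ) (b : Bool) :
    (restr X n)[i]? = some b ↔ i < n ∧ X i = b := by
  simp [restr, List.getElem?_eq_some_iff]

theorem prefix_iff (σ τ : List Bool) :
    σ <+: τ ↔ ∀ (i : ℕ) (b : Bool), σ[i]? = some b → τ[i]? = some b := by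
  rw [List.prefix_iff_getElem?]
  constructor
  · intro h i b hb
    obtain ⟨hi, rfl⟩ := List.getElem?_eq_some_iff.1 hb
    exact h i hi
  · intro h i hi
    exact h i _ (List.getElem?_eq_getElem hi)

theorem mem_cylinder_iff (σ : List Bool) (X : Cantor) :
    X ∈ cylinder σ ↔ ∀ (i : ℕ) (b : Bool), σ[i]? = some b → X i = b := by
  constructor
  · intro h i b hb
    have h' : restr X σ.length = σ := h
    rw [← h'] at hb
    exact ((getElem?_restr _ _ _ _).1 hb).2
  · intro h
    refine List.ext_getElem? fun i => ?_
    by_cases hi : i < σ.length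
    · rw [(getElem?_restr X σ.length i (X i)).2 ⟨hi, rfl⟩, List.getElem?_eq_getElem hi,
        h i _ (List.getElem?_eq_getElem hi)]
    · rw [List.getElem?_eq_none (by simpa using hi), List.getElem?_eq_none (by simpa using hi)]

theorem restr_prefix (X : Cantor) {m n : ℕ} (h : m ≤ n) : restr X m <+: restr X n := by
  rw [prefix_iff]
  intro i b hb
  rw [getElem?_restr] at *
  exact ⟨by omega, hb.2⟩

theorem mem_cylinder_restr (X : Cantor) (n : ℕ) : X ∈ cylinder (restr X n) := by
  rw [mem_cylinder_iff]
  intro i b hb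
  exact ((getElem?_restr _ _ _ _).1 hb).2

theorem restr_eq_of_prefix {σ : List Bool} {X : Cantor} {n : ℕ} (h : σ <+: restr X n) :
    σ = restr X σ.length := by
  have : X ∈ cylinder σ := by
    rw [mem_cylinder_iff]
    intro i b hb
    exact ((getElem?_restr _ _ _ _).1 ((prefix_iff _ _).1 h i b hb)).2
  exact this.symm

theorem prefix_restr {σ : List Bool} {X : Cantor} (h : X ∈ cylinder σ) {n : ℕ}
    (hn : σ.length ≤ n) : σ <+: restr X n := by
  have h' : restr X σ.length = σ := h
  rw [← h']
  exact restr_prefix X hn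

/-- Two strings agree on the positions where both are defined. -/
def Agree (σ τ : List Bool) : Prop :=
  ∀ (i : ℕ) (b c : Bool), σ[i]? = some b → τ[i]? = some c → b = c

theorem comparable_iff_agree (σ τ : List Bool) : (σ <+: τ ∨ τ <+: σ) ↔ Agree σ τ := by
  constructor
  · rintro (h | h) i b c hb hc
    · have := (prefix_iff _ _).1 h i b hb
      simp_all
    · have := (prefix_iff _ _).1 h i c hc
      simp_all
  · intro h
    rcases le_total σ.length τ.length with hl | hl
    · left
      rw [prefix_iff]
      intro i b hb
      obtain ⟨hi, -⟩ := List.getElem?_eq_some_iff.1 hb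
      have h2 : τ[i]? = some (τ[i]'(by omega)) := List.getElem?_eq_getElem _
      rw [h2, h i b _ hb h2]
    · right
      rw [prefix_iff]
      intro i b hb
      obtain ⟨hi, -⟩ := List.getElem?_eq_some_iff.1 hb
      have h2 : σ[i]? = some (σ[i]'(by omega)) := List.getElem?_eq_getElem _
      rw [h2, h i _ b h2 hb]

theorem Agree.mono {σ σ' τ τ' : List Bool} (h : Agree σ' τ') (h1 : σ <+: σ') (h2 : τ <+: τ') :
    Agree σ τ := fun i b c hb hc =>
  h i b c ((prefix_iff _ _).1 h1 i b hb) ((prefix_iff _ _).1 h2 i c hc)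

theorem agree_of_prefix {σ τ ρ : List Bool} (h1 : σ <+: ρ) (h2 : τ <+: ρ) : Agree σ τ :=
  fun i b c hb hc => by
    have := (prefix_iff _ _).1 h1 i b hb
    have := (prefix_iff _ _).1 h2 i c hc
    simp_all

/-- The bits of a string at even positions. -/
def evens (σ : List Bool) : List Bool :=
  (List.range ((σ.length + 1) / 2)).map fun i => σ.getD (2 * i) false

/-- The bits of a string at odd positions. -/
def odds (σ : List Bool) : List Bool :=
  (List.range (σ.length / 2)).map fun i => σ.getD (2 * i + 1) false

theorem getElem?_evens (σ : List Bool) (i : ℕ) : (evens σ)[i]? = σ[2 * i]? := by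
  by_cases h : 2 * i < σ.length
  · have h' : i < (σ.length + 1) / 2 := by omega
    simp [evens, h, h']
  · have h' : ¬ i < (σ.length + 1) / 2 := by omega
    rw [List.getElem?_eq_none (by simpa [evens] using h'),
      List.getElem?_eq_none (by simpa using h)]

theorem getElem?_odds (σ : List Bool) (i : ℕ) : (odds σ)[i]? = σ[2 * i + 1]? := by
  by_cases h : 2 * i + 1 < σ.length
  · have h' : i < σ.length / 2 := by omega
    simp [odds, h, h']
  · have h' : ¬ i < σ.length / 2 := by omega
    rw [List.getElem?_eq_none (by simpa [odds] using h'),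
      List.getElem?_eq_none (by simpa using h)]

theorem evens_mono {σ τ : List Bool} (h : σ <+: τ) : evens σ <+: evens τ := by
  rw [prefix_iff] at *
  intro i b hb
  rw [getElem?_evens] at *
  exact h _ _ hb

theorem odds_mono {σ τ : List Bool} (h : σ <+: τ) : odds σ <+: odds τ := by
  rw [prefix_iff] at *
  intro i b hb
  rw [getElem?_odds] at *
  exact h _ _ hb

theorem evens_restr_oplus (X Y : Cantor) (n : ℕ) : X ∈ cylinder (evens (restr (oplus X Y) n)) := by
  rw [mem_cylinder_iff]
  intro i b hb
  rw [getElem?_evens, getElem?_restr] at hb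
  simpa [oplus] using hb.2

theorem odds_restr_oplus (X Y : Cantor) (n : ℕ) : Y ∈ cylinder (odds (restr (oplus X Y) n)) := by
  rw [mem_cylinder_iff]
  intro i b hb
  rw [getElem?_odds, getElem?_restr] at hb
  have h1 : (2 * i + 1) % 2 = 1 := by omega
  have h2 : (2 * i + 1) / 2 = i := by omega
  simpa [oplus, h1, h2] using hb.2

theorem oplus_mem_cylinder {X Y : Cantor} {τ : List Bool} (h1 : X ∈ cylinder (evens τ))
    (h2 : Y ∈ cylinder (odds τ)) : oplus X Y ∈ cylinder τ := by
  rw [mem_cylinder_iff] at *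
  intro i b hb
  rcases Nat.mod_two_eq_zero_or_one i with hi | hi
  · have : 2 * (i / 2) = i := by omega
    simp only [oplus, hi, if_true]
    exact h1 _ _ (by rw [getElem?_evens, this, hb])
  · have : 2 * (i / 2) + 1 = i := by omega
    simp only [oplus, hi]
    exact h2 _ _ (by rw [getElem?_odds, this, hb])

theorem agree_of_evens_odds {σ τ : List Bool} (h1 : Agree (evens σ) (evens τ))
    (h2 : Agree (odds σ) (odds τ)) : Agree σ τ := by
  intro i b c hb hc
  rcases Nat.mod_two_eq_zero_or_one i with hi | hi
  · have : 2 * (i / 2) = i := by omega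
    exact h1 (i / 2) b c (by rw [getElem?_evens, this, hb]) (by rw [getElem?_evens, this, hc])
  · have : 2 * (i / 2) + 1 = i := by omega
    exact h2 (i / 2) b c (by rw [getElem?_odds, this, hb]) (by rw [getElem?_odds, this, hc])

theorem computable_evens : Computable evens := by
  have : Primrec evens :=
    Primrec.list_map
      (Primrec.list_range.comp (Primrec.nat_div2.comp (Primrec.succ.comp Primrec.list_length)
        |>.of_eq fun σ => Nat.div2_val _))
      ((Primrec.list_getD false).comp Primrec.fst
        (Primrec.nat_mul.comp (Primrec.const 2) Primrec.snd))
  exact this.to_comp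

theorem computable_odds : Computable odds := by
  have : Primrec odds :=
    Primrec.list_map
      (Primrec.list_range.comp (Primrec.nat_div2.comp Primrec.list_length
        |>.of_eq fun σ => Nat.div2_val _))
      ((Primrec.list_getD false).comp Primrec.fst
        (Primrec.succ.comp (Primrec.nat_mul.comp (Primrec.const 2) Primrec.snd)))
  exact this.to_comp

theorem consSeq_mem_cylinder (b c : Bool) (σ : List Bool) (X : Cantor) :
    consSeq b X ∈ cylinder (c :: σ) ↔ b = c ∧ X ∈ cylinder σ := by
  simp only [mem_cylinder_iff]
  constructor
  · intro h
    exact ⟨h 0 c (by simp), fun i d hd => h (i + 1) d (by simpa using hd)⟩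
  · rintro ⟨rfl, h⟩ i d hd
    cases i with
    | zero => simpa [consSeq] using hd
    | succ i => exact h i d (by simpa using hd)

theorem consSeq_eta (Z : Cantor) : consSeq (Z 0) (fun n => Z (n + 1)) = Z := by
  funext n
  cases n <;> rfl

theorem restr_consSeq (b : Bool) (X : Cantor) (n : ℕ) :
    restr (consSeq b X) (n + 1) = b :: restr X n := by
  have h : consSeq b X ∈ cylinder (b :: restr X n) :=
    (consSeq_mem_cylinder _ _ _ _).2 ⟨rfl, mem_cylinder_restr X n⟩
  have h' : restr (consSeq b X) (b :: restr X n).length = b :: restr X n := h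
  simpa using h'

theorem oplus_eta (Z : Cantor) : oplus (fun n => Z (2 * n)) (fun n => Z (2 * n + 1)) = Z := by
  funext n
  rcases Nat.mod_two_eq_zero_or_one n with hi | hi
  · have : 2 * (n / 2) = n := by omega
    simp [oplus, hi, this]
  · have : 2 * (n / 2) + 1 = n := by omega
    simp [oplus, hi, this]

theorem oplus_inj {X Y X' Y' : Cantor} (h : oplus X Y = oplus X' Y') : X = X' ∧ Y = Y' := by
  constructor
  · funext n
    simpa [oplus] using congrFun h (2 * n)
  · funext n
    have h1 : (2 * n + 1) % 2 = 1 := by omega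
    have h2 : (2 * n + 1) / 2 = n := by omega
    simpa [oplus, h1, h2] using congrFun h (2 * n + 1)

theorem consSeq_inj {b c : Bool} {X Y : Cantor} (h : consSeq b X = consSeq c Y) :
    b = c ∧ X = Y :=
  ⟨congrFun h 0, funext fun n => congrFun h (n + 1)⟩

/-! ### The infimum and supremum of two `Π⁰₁` classes -/

theorem isPi01_infSet {C D : Set Cantor} (hC : IsPi01 C) (hD : IsPi01 D) :
    IsPi01 (infSet C D) := by
  obtain ⟨S, hS, hSC⟩ := hC
  obtain ⟨T, hT, hTD⟩ := hD
  have key : ∀ (b : Bool) (S : Set (List Bool)), REPred (fun σ => σ ∈ S) →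
      REPred fun σ : List Bool => ∃ ρ, ρ ∈ S ∧ b :: ρ = σ := fun b S hS =>
    re_exists (re_and (re_comp hS Computable.snd)
      (re_eq (Computable.list_cons.comp (Computable.const b) Computable.snd) Computable.fst))
  refine ⟨{σ | (∃ ρ, ρ ∈ S ∧ false :: ρ = σ) ∨ ∃ ρ, ρ ∈ T ∧ true :: ρ = σ},
    re_or (key _ _ hS) (key _ _ hT), ?_⟩
  have hC' : ∀ X, X ∈ C ↔ ¬ ∃ ρ ∈ S, X ∈ cylinder ρ := fun X => by
    have : X ∈ Cᶜ ↔ ∃ ρ ∈ S, X ∈ cylinder ρ := by rw [hSC]; simp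
    rw [← this]; simp
  have hD' : ∀ X, X ∈ D ↔ ¬ ∃ ρ ∈ T, X ∈ cylinder ρ := fun X => by
    have : X ∈ Dᶜ ↔ ∃ ρ ∈ T, X ∈ cylinder ρ := by rw [hTD]; simp
    rw [← this]; simp
  ext Z
  obtain ⟨b, X, rfl⟩ : ∃ b X, Z = consSeq b X := ⟨_, _, (consSeq_eta Z).symm⟩
  have h1 : consSeq b X ∈ infSet C D ↔ (b = false ∧ X ∈ C) ∨ (b = true ∧ X ∈ D) := by
    constructor
    · rintro (⟨Y, hY, h⟩ | ⟨Y, hY, h⟩)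
      · obtain ⟨rfl, rfl⟩ := consSeq_inj h; exact Or.inl ⟨rfl, hY⟩
      · obtain ⟨rfl, rfl⟩ := consSeq_inj h; exact Or.inr ⟨rfl, hY⟩
    · rintro (⟨rfl, h⟩ | ⟨rfl, h⟩)
      · exact Or.inl ⟨X, h, rfl⟩
      · exact Or.inr ⟨X, h, rfl⟩
  rw [mem_compl_iff, h1, hC', hD']
  simp only [mem_iUnion, mem_ofPred_eq, exists_prop]
  constructor
  · intro h
    cases b with
    | false =>
      obtain ⟨ρ, hρ, hX⟩ : ∃ ρ ∈ S, X ∈ cylinder ρ := by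
        by_contra hc
        exact h (Or.inl ⟨rfl, hc⟩)
      exact ⟨false :: ρ, Or.inl ⟨ρ, hρ, rfl⟩, (consSeq_mem_cylinder _ _ _ _).2 ⟨rfl, hX⟩⟩
    | true =>
      obtain ⟨ρ, hρ, hX⟩ : ∃ ρ ∈ T, X ∈ cylinder ρ := by
        by_contra hc
        exact h (Or.inr ⟨rfl, hc⟩)
      exact ⟨true :: ρ, Or.inr ⟨ρ, hρ, rfl⟩, (consSeq_mem_cylinder _ _ _ _).2 ⟨rfl, hX⟩⟩
  · rintro ⟨σ, ⟨ρ, hρ, rfl⟩ | ⟨ρ, hρ, rfl⟩, hX⟩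
    · obtain ⟨rfl, hX'⟩ := (consSeq_mem_cylinder _ _ _ _).1 hX
      rintro (⟨-, h⟩ | ⟨h, -⟩)
      · exact h ⟨ρ, hρ, hX'⟩
      · cases h
    · obtain ⟨rfl, hX'⟩ := (consSeq_mem_cylinder _ _ _ _).1 hX
      rintro (⟨h, -⟩ | ⟨-, h⟩)
      · cases h
      · exact h ⟨ρ, hρ, hX'⟩

theorem isPi01_supSet {C D : Set Cantor} (hC : IsPi01 C) (hD : IsPi01 D) :
    IsPi01 (supSet C D) := by
  obtain ⟨S, hS, hSC⟩ := hC
  obtain ⟨T, hT, hTD⟩ := hD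
  refine ⟨{σ | (∃ ρ, ρ ∈ S ∧ ρ <+: evens σ) ∨ ∃ ρ, ρ ∈ T ∧ ρ <+: odds σ},
    re_or
      (re_exists (re_and (re_comp hS Computable.snd)
        (re_prefix Computable.snd (computable_evens.comp Computable.fst))))
      (re_exists (re_and (re_comp hT Computable.snd)
        (re_prefix Computable.snd (computable_odds.comp Computable.fst)))), ?_⟩
  have hC' : ∀ X, X ∈ C ↔ ¬ ∃ ρ ∈ S, X ∈ cylinder ρ := fun X => by
    have : X ∈ Cᶜ ↔ ∃ ρ ∈ S, X ∈ cylinder ρ := by rw [hSC]; simp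
    rw [← this]; simp
  have hD' : ∀ X, X ∈ D ↔ ¬ ∃ ρ ∈ T, X ∈ cylinder ρ := fun X => by
    have : X ∈ Dᶜ ↔ ∃ ρ ∈ T, X ∈ cylinder ρ := by rw [hTD]; simp
    rw [← this]; simp
  have trans : ∀ {ρ ρ' : List Bool} {X : Cantor}, ρ <+: ρ' → X ∈ cylinder ρ' →
      X ∈ cylinder ρ := by
    intro ρ ρ' X h hX
    rw [mem_cylinder_iff] at *
    exact fun i b hb => hX i b ((prefix_iff _ _).1 h i b hb)
  ext Z
  obtain ⟨X, Y, rfl⟩ : ∃ X Y, Z = oplus X Y := ⟨_, _, (oplus_eta Z).symm⟩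
  have h1 : oplus X Y ∈ supSet C D ↔ X ∈ C ∧ Y ∈ D := by
    constructor
    · rintro ⟨X', hX, Y', hY, h⟩
      obtain ⟨rfl, rfl⟩ := oplus_inj h
      exact ⟨hX, hY⟩
    · rintro ⟨hX, hY⟩
      exact ⟨X, hX, Y, hY, rfl⟩
  rw [mem_compl_iff, h1, hC', hD']
  simp only [mem_iUnion, mem_ofPred_eq, exists_prop]
  constructor
  · intro h
    by_cases hX : ∃ ρ ∈ S, X ∈ cylinder ρ
    · obtain ⟨ρ, hρ, hX⟩ := hX
      refine ⟨restr (oplus X Y) (2 * ρ.length), Or.inl ⟨ρ, hρ, ?_⟩, mem_cylinder_restr _ _⟩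
      rw [prefix_iff]
      intro i b hb
      obtain ⟨hi, -⟩ := List.getElem?_eq_some_iff.1 hb
      rw [getElem?_evens, getElem?_restr]
      exact ⟨by omega, by simpa [oplus] using (mem_cylinder_iff _ _).1 hX i b hb⟩
    · by_cases hY : ∃ ρ ∈ T, Y ∈ cylinder ρ
      · obtain ⟨ρ, hρ, hY⟩ := hY
        refine ⟨restr (oplus X Y) (2 * ρ.length + 1), Or.inr ⟨ρ, hρ, ?_⟩, mem_cylinder_restr _ _⟩
        rw [prefix_iff]
        intro i b hb
        obtain ⟨hi, -⟩ := List.getElem?_eq_some_iff.1 hb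
        rw [getElem?_odds, getElem?_restr]
        have h1 : (2 * i + 1) % 2 = 1 := by omega
        have h2 : (2 * i + 1) / 2 = i := by omega
        exact ⟨by omega, by simpa [oplus, h1, h2] using (mem_cylinder_iff _ _).1 hY i b hb⟩
      · exact absurd ⟨hX, hY⟩ h
  · rintro ⟨σ, ⟨ρ, hρ, hp⟩ | ⟨ρ, hρ, hp⟩, hZ⟩ ⟨hX, hY⟩
    · refine hX ⟨ρ, hρ, trans hp ?_⟩
      have hZ' : restr (oplus X Y) σ.length = σ := hZ
      rw [← hZ']
      exact evens_restr_oplus X Y _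
    · refine hY ⟨ρ, hρ, trans hp ?_⟩
      have hZ' : restr (oplus X Y) σ.length = σ := hZ
      rw [← hZ']
      exact odds_restr_oplus X Y _

/-- `inf(C, D)` as a `Π⁰₁` class. -/
def Pi01Class.inf (C D : Pi01Class) : Pi01Class :=
  ⟨infSet C.carrier D.carrier, isPi01_infSet C.isPi01 D.isPi01⟩

/-- `sup(C, D)` as a `Π⁰₁` class. -/
def Pi01Class.sup (C D : Pi01Class) : Pi01Class :=
  ⟨supSet C.carrier D.carrier, isPi01_supSet C.isPi01 D.isPi01⟩

/-! ### Turing functionals needed for the lattice structure -/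

namespace TuringFunctional

theorem agree_outputs (Φ : TuringFunctional) {X : Cantor} {τ τ' : List Bool}
    (h : τ ∈ Φ.outputs X) (h' : τ' ∈ Φ.outputs X) : Agree τ τ' := by
  obtain ⟨m, hm⟩ := h
  obtain ⟨n, hn⟩ := h'
  rw [← comparable_iff_agree]
  rcases le_total m n with hmn | hmn
  · exact Φ.consistent _ _ _ _ hm hn (restr_prefix X hmn)
  · exact (Φ.consistent _ _ _ _ hn hm (restr_prefix X hmn)).symm

/-- `X ∈ dom Φ` and `Φ(X) = Y`. -/
def Maps (Φ : TuringFunctional) (X Y : Cantor) : Prop := X ∈ Φ.dom ∧ Φ.eval X = Y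

theorem eval_mem_cylinder (Φ : TuringFunctional) {X : Cantor} {τ : List Bool}
    (h : τ ∈ Φ.outputs X) : Φ.eval X ∈ cylinder τ := by
  rw [mem_cylinder_iff]
  intro i b hb
  cases b with
  | true =>
    simp only [eval, decide_eq_true_eq]
    exact ⟨τ, h, hb⟩
  | false =>
    simp only [eval, decide_eq_false_iff_not]
    rintro ⟨τ', h', hb'⟩
    exact absurd (Φ.agree_outputs h h' i _ _ hb hb') (by simp)

theorem maps_iff (Φ : TuringFunctional) (X Y : Cantor) :
    Φ.Maps X Y ↔ X ∈ Φ.dom ∧ ∀ τ ∈ Φ.outputs X, Y ∈ cylinder τ := by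
  constructor
  · rintro ⟨h, rfl⟩
    exact ⟨h, fun τ hτ => Φ.eval_mem_cylinder hτ⟩
  · rintro ⟨h, h'⟩
    refine ⟨h, funext fun i => ?_⟩
    obtain ⟨τ, hτ, hl⟩ := h (i + 1)
    have h2 : τ[i]? = some (τ[i]'(by omega)) := List.getElem?_eq_getElem _
    rw [(mem_cylinder_iff _ _).1 (Φ.eval_mem_cylinder hτ) i _ h2,
      (mem_cylinder_iff _ _).1 (h' τ hτ) i _ h2]

theorem maps_restr {Φ : TuringFunctional} {X Y : Cantor} (h : Φ.Maps X Y) (n : ℕ) :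
    ∃ τ m, (restr X m, τ) ∈ Φ.graph ∧ restr Y n <+: τ := by
  obtain ⟨h1, h2⟩ := (Φ.maps_iff X Y).1 h
  obtain ⟨τ, ⟨m, hm⟩, hl⟩ := h1 n
  refine ⟨τ, m, hm, ?_⟩
  have h3 : restr Y τ.length = τ := h2 τ ⟨m, hm⟩
  rw [← h3]
  exact restr_prefix Y hl

/-- The functional given by a computable monotone map on strings. -/
def ofMono (f : List Bool → List Bool) (hf : Computable f)
    (hm : ∀ σ σ', σ <+: σ' → f σ <+: f σ') : TuringFunctional where
  graph := {p | f p.1 = p.2}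
  re := re_eq (hf.comp Computable.fst) Computable.snd
  consistent := by
    intro σ τ σ' τ' h h' hp
    have h1 : f σ = τ := h
    have h2 : f σ' = τ' := h'
    subst h1 h2
    exact Or.inl (hm _ _ hp)

theorem ofMono_maps {f : List Bool → List Bool} (hf : Computable f)
    (hm : ∀ σ σ', σ <+: σ' → f σ <+: f σ') {X Y : Cantor}
    (h : ∀ n, Y ∈ cylinder (f (restr X n))) (h' : ∀ n, ∃ m, n ≤ (f (restr X m)).length) :
    (ofMono f hf hm).Maps X Y := by
  rw [maps_iff]
  constructor
  · intro n
    obtain ⟨m, hm⟩ := h' n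
    exact ⟨f (restr X m), ⟨m, show f (restr X m) = f (restr X m) from rfl⟩, hm⟩
  · rintro τ ⟨n, hn⟩
    have hn' : f (restr X n) = τ := hn
    rw [← hn']
    exact h n

theorem exists_id : ∃ Θ : TuringFunctional, ∀ X, Θ.Maps X X :=
  ⟨ofMono id Computable.id fun _ _ h => h, fun X =>
    ofMono_maps _ _ (fun n => mem_cylinder_restr X n) fun n => ⟨n, by simp⟩⟩

theorem exists_cons (b : Bool) : ∃ Θ : TuringFunctional, ∀ X, Θ.Maps X (consSeq b X) :=
  ⟨ofMono (List.cons b) (Computable.list_cons.comp (Computable.const b) Computable.id)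
      fun _ _ h => (List.cons_prefix_cons).2 ⟨rfl, h⟩, fun X =>
    ofMono_maps _ _ (fun n => (consSeq_mem_cylinder _ _ _ _).2 ⟨rfl, mem_cylinder_restr X n⟩)
      fun n => ⟨n, by simp⟩⟩

theorem exists_left : ∃ Θ : TuringFunctional, ∀ X Y, Θ.Maps (oplus X Y) X :=
  ⟨ofMono evens computable_evens fun _ _ h => evens_mono h, fun X Y =>
    ofMono_maps _ _ (fun n => evens_restr_oplus X Y n)
      fun n => ⟨2 * n, by simp [evens]; omega⟩⟩

theorem exists_right : ∃ Θ : TuringFunctional, ∀ X Y, Θ.Maps (oplus X Y) Y :=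
  ⟨ofMono odds computable_odds fun _ _ h => odds_mono h, fun X Y =>
    ofMono_maps _ _ (fun n => odds_restr_oplus X Y n)
      fun n => ⟨2 * n, by simp [odds]⟩⟩

theorem exists_comp (Ψ Φ : TuringFunctional) :
    ∃ Θ : TuringFunctional, ∀ X Y Z, Φ.Maps X Y → Ψ.Maps Y Z → Θ.Maps X Z := by
  refine ⟨⟨{p | ∃ q : List Bool × List Bool,
    (p.1, q.1) ∈ Φ.graph ∧ (q.2, p.2) ∈ Ψ.graph ∧ q.2 <+: q.1}, ?_, ?_⟩, ?_⟩
  · refine re_exists (re_and (re_comp Φ.re ?_) (re_and (re_comp Ψ.re ?_) (re_prefix ?_ ?_)))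
    · exact (Computable.fst.comp Computable.fst).pair (Computable.fst.comp Computable.snd)
    · exact (Computable.snd.comp Computable.snd).pair (Computable.snd.comp Computable.fst)
    · exact Computable.snd.comp Computable.snd
    · exact Computable.fst.comp Computable.snd
  · rintro σ τ σ' τ' ⟨⟨q, r⟩, h1, h2, h3⟩ ⟨⟨q', r'⟩, h1', h2', h3'⟩ hp
    have hq := (comparable_iff_agree _ _).1 (Φ.consistent _ _ _ _ h1 h1' hp)
    rcases (comparable_iff_agree _ _).2 (hq.mono h3 h3') with h | h
    · exact Ψ.consistent _ _ _ _ h2 h2' h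
    · exact (Ψ.consistent _ _ _ _ h2' h2 h).symm
  · intro X Y Z hXY hYZ
    obtain ⟨hY1, hY2⟩ := (Φ.maps_iff _ _).1 hXY
    obtain ⟨hZ1, hZ2⟩ := (Ψ.maps_iff _ _).1 hYZ
    rw [maps_iff]
    constructor
    · intro n
      obtain ⟨τ, ⟨m, hm⟩, hl⟩ := hZ1 n
      obtain ⟨ρ, k, hk, hpre⟩ := maps_restr hXY m
      exact ⟨τ, ⟨k, ⟨(ρ, restr Y m), hk, hm, hpre⟩⟩, hl⟩
    · rintro τ ⟨n, ⟨⟨q, r⟩, h1, h2, h3⟩⟩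
      have hq : restr Y q.length = q := hY2 q ⟨n, h1⟩
      have hr : r = restr Y r.length := by
        refine restr_eq_of_prefix (n := q.length) ?_
        rw [hq]
        exact h3
      refine hZ2 τ ⟨r.length, ?_⟩
      rw [← hr]
      exact h2

theorem exists_cases (Φ Ψ : TuringFunctional) :
    ∃ Θ : TuringFunctional, ∀ X Y, (Φ.Maps X Y → Θ.Maps (consSeq false X) Y) ∧
      (Ψ.Maps X Y → Θ.Maps (consSeq true X) Y) := by
  have key : ∀ (b : Bool) (Φ : TuringFunctional), REPred fun p : List Bool × List Bool =>
      ∃ ρ, (ρ, p.2) ∈ Φ.graph ∧ b :: ρ = p.1 := fun b Φ =>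
    re_exists (re_and
      (re_comp Φ.re (Computable.snd.pair (Computable.snd.comp Computable.fst)))
      (re_eq (Computable.list_cons.comp (Computable.const b) Computable.snd)
        (Computable.fst.comp Computable.fst)))
  refine ⟨⟨{p | (∃ ρ, (ρ, p.2) ∈ Φ.graph ∧ false :: ρ = p.1) ∨
    ∃ ρ, (ρ, p.2) ∈ Ψ.graph ∧ true :: ρ = p.1}, re_or (key _ _) (key _ _), ?_⟩, ?_⟩
  · rintro σ τ σ' τ' (⟨ρ, h, rfl⟩ | ⟨ρ, h, rfl⟩) (⟨ρ', h', rfl⟩ | ⟨ρ', h', rfl⟩) hp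
    · exact Φ.consistent _ _ _ _ h h' (List.cons_prefix_cons.1 hp).2
    · exact absurd (List.cons_prefix_cons.1 hp).1 (by simp)
    · exact absurd (List.cons_prefix_cons.1 hp).1 (by simp)
    · exact Ψ.consistent _ _ _ _ h h' (List.cons_prefix_cons.1 hp).2
  · have inv : ∀ {b c : Bool} {X : Cantor} {ρ : List Bool} {n : ℕ},
        c :: ρ = restr (consSeq b X) n → c = b ∧ ρ = restr X ρ.length := by
      intro b c X ρ n h
      have h1 : consSeq b X ∈ cylinder (c :: ρ) := by
        rw [h]
        exact mem_cylinder_restr _ _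
      obtain ⟨h2, h3⟩ := (consSeq_mem_cylinder _ _ _ _).1 h1
      exact ⟨h2.symm, h3.symm⟩
    intro X Y
    constructor
    · intro h
      obtain ⟨h1, h2⟩ := (maps_iff _ _ _).1 h
      rw [maps_iff]
      constructor
      · intro n
        obtain ⟨τ, ⟨m, hm⟩, hl⟩ := h1 n
        exact ⟨τ, ⟨m + 1, Or.inl ⟨_, hm, (restr_consSeq _ _ _).symm⟩⟩, hl⟩
      · rintro τ ⟨n, ⟨ρ, hρ, he⟩ | ⟨ρ, hρ, he⟩⟩
        · obtain ⟨-, he⟩ := inv he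
          rw [he] at hρ
          exact h2 τ ⟨_, hρ⟩
        · exact absurd (inv he).1 (by simp)
    · intro h
      obtain ⟨h1, h2⟩ := (maps_iff _ _ _).1 h
      rw [maps_iff]
      constructor
      · intro n
        obtain ⟨τ, ⟨m, hm⟩, hl⟩ := h1 n
        exact ⟨τ, ⟨m + 1, Or.inr ⟨_, hm, (restr_consSeq _ _ _).symm⟩⟩, hl⟩
      · rintro τ ⟨n, ⟨ρ, hρ, he⟩ | ⟨ρ, hρ, he⟩⟩
        · exact absurd (inv he).1 (by simp)
        · obtain ⟨-, he⟩ := inv he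
          rw [he] at hρ
          exact h2 τ ⟨_, hρ⟩

theorem exists_pair (Φ Ψ : TuringFunctional) :
    ∃ Θ : TuringFunctional, ∀ X Y Z, Φ.Maps X Y → Ψ.Maps X Z → Θ.Maps X (oplus Y Z) := by
  have key : ∀ (Φ : TuringFunctional) (f : List Bool → List Bool), Computable f →
      REPred fun p : List Bool × List Bool => ∃ q : List Bool × List Bool,
        q ∈ Φ.graph ∧ q.1 <+: p.1 ∧ f p.2 <+: q.2 := fun Φ f hf =>
    re_exists (re_and (re_comp Φ.re Computable.snd) (re_and
      (re_prefix (Computable.fst.comp Computable.snd) (Computable.fst.comp Computable.fst))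
      (re_prefix (hf.comp (Computable.snd.comp Computable.fst))
        (Computable.snd.comp Computable.snd))))
  have ag : ∀ (Φ : TuringFunctional) {q q' : List Bool × List Bool} {σ : List Bool},
      q ∈ Φ.graph → q' ∈ Φ.graph → q.1 <+: σ → q'.1 <+: σ → Agree q.2 q'.2 := by
    intro Φ q q' σ h h' hp hp'
    rw [← comparable_iff_agree]
    rcases (comparable_iff_agree _ _).2 (agree_of_prefix hp hp') with h1 | h1
    · exact Φ.consistent _ _ _ _ h h' h1
    · exact (Φ.consistent _ _ _ _ h' h h1).symm
  refine ⟨⟨{p | (∃ q, q ∈ Φ.graph ∧ q.1 <+: p.1 ∧ evens p.2 <+: q.2) ∧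
    ∃ q, q ∈ Ψ.graph ∧ q.1 <+: p.1 ∧ odds p.2 <+: q.2},
    re_and (key _ _ computable_evens) (key _ _ computable_odds), ?_⟩, ?_⟩
  · rintro σ τ σ' τ' ⟨⟨q, h1, h2, h3⟩, ⟨r, k1, k2, k3⟩⟩ ⟨⟨q', h1', h2', h3'⟩, ⟨r', k1', k2', k3'⟩⟩ hp
    rw [comparable_iff_agree]
    exact agree_of_evens_odds ((ag Φ h1 h1' (h2.trans hp) h2').mono h3 h3')
      ((ag Ψ k1 k1' (k2.trans hp) k2').mono k3 k3')
  · intro X Y Z hY hZ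
    have hY2 := ((maps_iff _ _ _).1 hY).2
    have hZ2 := ((maps_iff _ _ _).1 hZ).2
    have out : ∀ (Φ : TuringFunctional) (W : Cantor) (n : ℕ) (q : List Bool × List Bool)
        (ρ : List Bool), (∀ τ ∈ Φ.outputs X, W ∈ cylinder τ) → q ∈ Φ.graph →
        q.1 <+: restr X n → ρ <+: q.2 → W ∈ cylinder ρ := by
      intro Φ W n q ρ hW hq hp hρ
      have h1 : q.2 ∈ Φ.outputs X := by
        refine ⟨q.1.length, ?_⟩
        rw [← restr_eq_of_prefix hp]
        exact hq
      have h2 := hW _ h1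
      rw [mem_cylinder_iff] at *
      exact fun i b hb => h2 i b ((prefix_iff _ _).1 hρ i b hb)
    rw [maps_iff]
    constructor
    · intro n
      obtain ⟨ρ, m, hm, hρ⟩ := maps_restr hY n
      obtain ⟨ρ', m', hm', hρ'⟩ := maps_restr hZ n
      refine ⟨restr (oplus Y Z) n, ⟨max m m', ⟨(restr X m, ρ), hm, ?_, ?_⟩,
        ⟨(restr X m', ρ'), hm', ?_, ?_⟩⟩, by simp⟩
      · exact restr_prefix X (le_max_left _ _)
      · refine (prefix_restr (evens_restr_oplus Y Z n) ?_).trans hρ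
        simp [evens]
        omega
      · exact restr_prefix X (le_max_right _ _)
      · refine (prefix_restr (odds_restr_oplus Y Z n) ?_).trans hρ'
        simp [odds]
        omega
    · rintro τ ⟨n, ⟨q, h1, h2, h3⟩, ⟨r, k1, k2, k3⟩⟩
      exact oplus_mem_cylinder (out Φ Y n q _ hY2 h1 h2 h3) (out Ψ Z n r _ hZ2 k1 k2 k3)

end TuringFunctional

open TuringFunctional

theorem muchnikLE_iff (C D : Pi01Class) : MuchnikLE C D ↔
    ∀ X ∈ D.carrier, ∃ Φ : TuringFunctional, ∃ Y ∈ C.carrier, Φ.Maps X Y := by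
  constructor
  · intro h X hX
    obtain ⟨Φ, h1, h2⟩ := h X hX
    exact ⟨Φ, _, h2, h1, rfl⟩
  · intro h X hX
    obtain ⟨Φ, Y, hY, h1, rfl⟩ := h X hX
    exact ⟨Φ, h1, hY⟩

theorem medvedevLE_iff (C D : Pi01Class) : MedvedevLE C D ↔
    ∃ Φ : TuringFunctional, ∀ X ∈ D.carrier, ∃ Y ∈ C.carrier, Φ.Maps X Y := by
  constructor
  · rintro ⟨Φ, h1, h2⟩
    exact ⟨Φ, fun X hX => ⟨_, h2 ⟨X, hX, rfl⟩, h1 hX, rfl⟩⟩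
  · rintro ⟨Φ, h⟩
    refine ⟨Φ, fun X hX => ?_, ?_⟩
    · obtain ⟨Y, -, h1, -⟩ := h X hX
      exact h1
    · rintro _ ⟨X, hX, rfl⟩
      obtain ⟨Y, hY, -, rfl⟩ := h X hX
      exact hY

/-! ### Degree lattices -/

/-- The facts which make the degrees of a reducibility on `Π⁰₁` classes a lattice with the given
infimum and supremum. -/
structure IsLatticeReducibility (r : Pi01Class → Pi01Class → Prop) : Prop where
  refl : ∀ C, r C C
  trans : ∀ C D E, r C D → r D E → r C E
  inf_left : ∀ C D : Pi01Class, r (C.inf D) C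
  inf_right : ∀ C D : Pi01Class, r (C.inf D) D
  le_inf : ∀ C D E : Pi01Class, r E C → r E D → r E (C.inf D)
  sup_left : ∀ C D : Pi01Class, r C (C.sup D)
  sup_right : ∀ C D : Pi01Class, r D (C.sup D)
  sup_le : ∀ C D E : Pi01Class, r C E → r D E → r (C.sup D) E

theorem muchnik_isLatticeReducibility : IsLatticeReducibility MuchnikLE where
  refl C := (muchnikLE_iff _ _).2 fun X hX => exists_id.imp fun Θ h => ⟨X, hX, h X⟩
  trans C D E h1 h2 := by
    rw [muchnikLE_iff] at *
    intro X hX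
    obtain ⟨Φ, Y, hY, hΦ⟩ := h2 X hX
    obtain ⟨Ψ, Z, hZ, hΨ⟩ := h1 Y hY
    obtain ⟨Θ, hΘ⟩ := exists_comp Ψ Φ
    exact ⟨Θ, Z, hZ, hΘ X Y Z hΦ hΨ⟩
  inf_left C D := (muchnikLE_iff _ _).2 fun X hX =>
    (exists_cons false).imp fun Θ h => ⟨_, Or.inl ⟨X, hX, rfl⟩, h X⟩
  inf_right C D := (muchnikLE_iff _ _).2 fun X hX =>
    (exists_cons true).imp fun Θ h => ⟨_, Or.inr ⟨X, hX, rfl⟩, h X⟩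
  le_inf C D E h1 h2 := by
    rw [muchnikLE_iff] at *
    rintro _ (⟨X, hX, rfl⟩ | ⟨X, hX, rfl⟩)
    · obtain ⟨Φ, Y, hY, hΦ⟩ := h1 X hX
      obtain ⟨Θ, hΘ⟩ := exists_cases Φ Φ
      exact ⟨Θ, Y, hY, (hΘ X Y).1 hΦ⟩
    · obtain ⟨Φ, Y, hY, hΦ⟩ := h2 X hX
      obtain ⟨Θ, hΘ⟩ := exists_cases Φ Φ
      exact ⟨Θ, Y, hY, (hΘ X Y).2 hΦ⟩
  sup_left C D := (muchnikLE_iff _ _).2 fun Z hZ => by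
    obtain ⟨X, hX, Y, hY, rfl⟩ := hZ
    exact exists_left.imp fun Θ h => ⟨X, hX, h X Y⟩
  sup_right C D := (muchnikLE_iff _ _).2 fun Z hZ => by
    obtain ⟨X, hX, Y, hY, rfl⟩ := hZ
    exact exists_right.imp fun Θ h => ⟨Y, hY, h X Y⟩
  sup_le C D E h1 h2 := by
    rw [muchnikLE_iff] at *
    intro X hX
    obtain ⟨Φ, Y, hY, hΦ⟩ := h1 X hX
    obtain ⟨Ψ, Z, hZ, hΨ⟩ := h2 X hX
    obtain ⟨Θ, hΘ⟩ := exists_pair Φ Ψ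
    exact ⟨Θ, _, ⟨Y, hY, Z, hZ, rfl⟩, hΘ X Y Z hΦ hΨ⟩

theorem medvedev_isLatticeReducibility : IsLatticeReducibility MedvedevLE where
  refl C := (medvedevLE_iff _ _).2 <| exists_id.imp fun Θ h X hX => ⟨X, hX, h X⟩
  trans C D E h1 h2 := by
    rw [medvedevLE_iff] at *
    obtain ⟨Φ, hΦ⟩ := h2
    obtain ⟨Ψ, hΨ⟩ := h1
    obtain ⟨Θ, hΘ⟩ := exists_comp Ψ Φ
    refine ⟨Θ, fun X hX => ?_⟩
    obtain ⟨Y, hY, hΦ⟩ := hΦ X hX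
    obtain ⟨Z, hZ, hΨ⟩ := hΨ Y hY
    exact ⟨Z, hZ, hΘ X Y Z hΦ hΨ⟩
  inf_left C D := (medvedevLE_iff _ _).2 <|
    (exists_cons false).imp fun Θ h X hX => ⟨_, Or.inl ⟨X, hX, rfl⟩, h X⟩
  inf_right C D := (medvedevLE_iff _ _).2 <|
    (exists_cons true).imp fun Θ h X hX => ⟨_, Or.inr ⟨X, hX, rfl⟩, h X⟩
  le_inf C D E h1 h2 := by
    rw [medvedevLE_iff] at *
    obtain ⟨Φ, hΦ⟩ := h1
    obtain ⟨Ψ, hΨ⟩ := h2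
    obtain ⟨Θ, hΘ⟩ := exists_cases Φ Ψ
    refine ⟨Θ, ?_⟩
    rintro _ (⟨X, hX, rfl⟩ | ⟨X, hX, rfl⟩)
    · obtain ⟨Y, hY, hΦ⟩ := hΦ X hX
      exact ⟨Y, hY, (hΘ X Y).1 hΦ⟩
    · obtain ⟨Y, hY, hΨ⟩ := hΨ X hX
      exact ⟨Y, hY, (hΘ X Y).2 hΨ⟩
  sup_left C D := (medvedevLE_iff _ _).2 <| exists_left.imp fun Θ h Z hZ => by
    obtain ⟨X, hX, Y, hY, rfl⟩ := hZ
    exact ⟨X, hX, h X Y⟩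
  sup_right C D := (medvedevLE_iff _ _).2 <| exists_right.imp fun Θ h Z hZ => by
    obtain ⟨X, hX, Y, hY, rfl⟩ := hZ
    exact ⟨Y, hY, h X Y⟩
  sup_le C D E h1 h2 := by
    rw [medvedevLE_iff] at *
    obtain ⟨Φ, hΦ⟩ := h1
    obtain ⟨Ψ, hΨ⟩ := h2
    obtain ⟨Θ, hΘ⟩ := exists_pair Φ Ψ
    refine ⟨Θ, fun X hX => ?_⟩
    obtain ⟨Y, hY, hΦ⟩ := hΦ X hX
    obtain ⟨Z, hZ, hΨ⟩ := hΨ X hX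
    exact ⟨_, ⟨Y, hY, Z, hZ, rfl⟩, hΘ X Y Z hΦ hΨ⟩

/-- `C ≡ D` if and only if `C ≤ D` and `D ≤ C`. -/
def degreeSetoid {r : Pi01Class → Pi01Class → Prop} (h : IsLatticeReducibility r) :
    Setoid Pi01Class where
  r C D := r C D ∧ r D C
  iseqv :=
    ⟨fun C => ⟨h.refl C, h.refl C⟩, fun h => ⟨h.2, h.1⟩,
      fun h1 h2 => ⟨h.trans _ _ _ h1.1 h2.1, h.trans _ _ _ h2.2 h1.2⟩⟩

/-- The lattice of degrees, ordered by `[C] ≤ [D] ↔ C ≤ D`, with `[C] ⊓ [D] = [inf(C, D)]` and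
`[C] ⊔ [D] = [sup(C, D)]`. -/
@[reducible]
def degreeLattice {r : Pi01Class → Pi01Class → Prop} (h : IsLatticeReducibility r) :
    Lattice (Quotient (degreeSetoid h)) where
  le := Quotient.lift₂ r fun _ _ _ _ h1 h2 => propext
    ⟨fun hr => h.trans _ _ _ h1.2 (h.trans _ _ _ hr h2.1),
      fun hr => h.trans _ _ _ h1.1 (h.trans _ _ _ hr h2.2)⟩
  le_refl := by
    rintro ⟨C⟩
    exact h.refl C
  le_trans := by
    rintro ⟨C⟩ ⟨D⟩ ⟨E⟩ h1 h2
    exact h.trans C D E h1 h2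
  le_antisymm := by
    rintro ⟨C⟩ ⟨D⟩ h1 h2
    exact Quotient.sound ⟨h1, h2⟩
  inf := Quotient.map₂ Pi01Class.inf fun C C' h1 D D' h2 =>
    ⟨h.le_inf _ _ _ (h.trans _ _ _ (h.inf_left C D) h1.1) (h.trans _ _ _ (h.inf_right C D) h2.1),
      h.le_inf _ _ _ (h.trans _ _ _ (h.inf_left C' D') h1.2)
        (h.trans _ _ _ (h.inf_right C' D') h2.2)⟩
  sup := Quotient.map₂ Pi01Class.sup fun C C' h1 D D' h2 =>
    ⟨h.sup_le _ _ _ (h.trans _ _ _ h1.1 (h.sup_left C' D')) (h.trans _ _ _ h2.1 (h.sup_right C' D')),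
      h.sup_le _ _ _ (h.trans _ _ _ h1.2 (h.sup_left C D)) (h.trans _ _ _ h2.2 (h.sup_right C D))⟩
  inf_le_left := by
    rintro ⟨C⟩ ⟨D⟩
    exact h.inf_left C D
  inf_le_right := by
    rintro ⟨C⟩ ⟨D⟩
    exact h.inf_right C D
  le_inf := by
    rintro ⟨E⟩ ⟨C⟩ ⟨D⟩ h1 h2
    exact h.le_inf C D E h1 h2
  le_sup_left := by
    rintro ⟨C⟩ ⟨D⟩
    exact h.sup_left C D
  le_sup_right := by
    rintro ⟨C⟩ ⟨D⟩
    exact h.sup_right C D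
  sup_le := by
    rintro ⟨C⟩ ⟨D⟩ ⟨E⟩ h1 h2
    exact h.sup_le C D E h1 h2

/-- The Medvedev degrees of `Π⁰₁` classes. -/
def MedvedevDegree : Type := Quotient (degreeSetoid medvedev_isLatticeReducibility)

/-- The Muchnik degrees of `Π⁰₁` classes. -/
def MuchnikDegree : Type := Quotient (degreeSetoid muchnik_isLatticeReducibility)

instance : Lattice MedvedevDegree := degreeLattice medvedev_isLatticeReducibility

instance : Lattice MuchnikDegree := degreeLattice muchnik_isLatticeReducibility

/-- The Medvedev degree of a `Π⁰₁` class. -/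
def medvedevDeg (C : Pi01Class) : MedvedevDegree :=
  Quotient.mk (degreeSetoid medvedev_isLatticeReducibility) C

/-- The Muchnik degree of a `Π⁰₁` class. -/
def muchnikDeg (C : Pi01Class) : MuchnikDegree :=
  Quotient.mk (degreeSetoid muchnik_isLatticeReducibility) C

theorem medvedevDeg_le (C D : Pi01Class) : medvedevDeg C ≤ medvedevDeg D ↔ MedvedevLE C D :=
  Iff.rfl

theorem muchnikDeg_le (C D : Pi01Class) : muchnikDeg C ≤ muchnikDeg D ↔ MuchnikLE C D :=
  Iff.rfl

theorem medvedevDeg_inf (C D : Pi01Class) :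
    medvedevDeg C ⊓ medvedevDeg D = medvedevDeg (C.inf D) := rfl

theorem muchnikDeg_inf (C D : Pi01Class) :
    muchnikDeg C ⊓ muchnikDeg D = muchnikDeg (C.inf D) := rfl

/-- A filter in a lattice: a nonempty, upward closed set which is closed under `⊓`. -/
def IsLatticeFilter {L : Type*} [Lattice L] (F : Set L) : Prop :=
  F.Nonempty ∧ (∀ x y, x ∈ F → x ≤ y → y ∈ F) ∧ ∀ x y, x ∈ F → y ∈ F → x ⊓ y ∈ F

end MassProblems

namespace MassProblems

/-! A `Π⁰₁` class `C` is the set of paths through a computable tree whose clopen approximations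
decrease to `C` (`exists_tree`). If `C` is null for a computable `μ`, the masses of these
approximations tend to 0. A stage where the mass is below `2⁻ᵏ` can then be found by search
(`IsComputableMeasure.exists_stage`), and inverting this modulus of convergence gives the order that
tt-depth asks for (`exists_computableOrder`, `IsPi01.ttDeep`). Conversely, the mass of every level
of the canonical tree bounds `μ C`. So the rest can be proved for tt-negligibility, which is a
statement about measure alone.

The main point is that tt-negligibility passes upward along Muchnik reducibility
(`MuchnikLE.ttNegligible`). Let `C` be tt-negligible and suppose a computable `μ` gives `D` positive
measure. For a functional `Φ`, every `Π⁰₁` class of positive measure has a `Π⁰₁` subclass, still of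
positive measure, on which `Φ` never computes a member of `C` (`exists_subclass`). If there were
none, `Φ` would be total with values in `C` almost everywhere on the class. Waiting for each output
bit up to a computable stage, with errors summing to less than the measure of the class, would give
a total map of tt type (`exists_total`). Its image measure is computable and charges `C`, a
contradiction. There are countably many functionals, so iterating over all of them and using
compactness yields a member of `D` that computes no member of `C`.

Medvedev reducibility implies Muchnik reducibility, so invariance and upward closure hold in both
lattices. For meets, deleting the first bit sends a computable measure to a computable measure. The
empty class makes both filters nonempty. -/

/-! ### Bounded operations on computable functions -/

/-- The first value that is not `none` among `h 0, …, h (n - 1)`. -/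
def firstSome {β : Type*} (h : ℕ → Option β) (n : ℕ) : Option β :=
  Nat.rec none (fun k acc => acc <|> h k) n

theorem firstSome_succ {β : Type*} (h : ℕ → Option β) (n : ℕ) :
    firstSome h (n + 1) = (firstSome h n <|> h n) := rfl

theorem firstSome_mono {β : Type*} {h : ℕ → Option β} {m n : ℕ} (hmn : m ≤ n) {b : β}
    (hb : firstSome h m = some b) : firstSome h n = some b := by
  induction n, hmn using Nat.le_induction with
  | base => exact hb
  | succ n _ ih => simp [firstSome_succ, ih]

theorem exists_of_firstSome {β : Type*} {h : ℕ → Option β} {n : ℕ} {b : β}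
    (hb : firstSome h n = some b) : ∃ k < n, h k = some b := by
  induction n with
  | zero => simp [firstSome] at hb
  | succ n ih =>
    rw [firstSome_succ] at hb
    cases h' : firstSome h n with
    | none =>
      rw [h'] at hb
      exact ⟨n, n.lt_succ_self, by simpa using hb⟩
    | some c =>
      rw [h'] at hb
      obtain ⟨k, hk, hk'⟩ := ih (by simpa [h'] using hb)
      exact ⟨k, hk.trans n.lt_succ_self, hk'⟩

theorem isSome_firstSome {β : Type*} {h : ℕ → Option β} {n k : ℕ} (hk : k < n) {b : β}
    (hb : h k = some b) : (firstSome h n).isSome := by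
  have h1 : (firstSome h (k + 1)).isSome := by
    rw [firstSome_succ, hb]
    cases firstSome h k <;> simp
  obtain ⟨c, hc⟩ := Option.isSome_iff_exists.1 h1
  simp [firstSome_mono hk hc]

theorem firstSome_congr {β : Type*} {h h' : ℕ → Option β} {n : ℕ} (H : ∀ k < n, h k = h' k) :
    firstSome h n = firstSome h' n := by
  induction n with
  | zero => rfl
  | succ n ih =>
    rw [firstSome_succ, firstSome_succ, ih fun k hk => H k (hk.trans n.lt_succ_self),
      H n n.lt_succ_self]

section Computability

variable {α : Type*} [Primcodable α]

theorem computable_firstSome {β : Type*} [Primcodable β] {h : α → ℕ → Option β} (hh : Computable₂ h) {n : α → ℕ}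
    (hn : Computable n) : Computable fun a => firstSome (h a) (n a) :=
  Computable.nat_rec hn (Computable.const none)
    (Primrec.option_orElse.to_comp.comp (Computable.snd.comp Computable.snd)
      (hh.comp Computable.fst (Computable.fst.comp Computable.snd))).to₂

theorem computable_sum_range {f : α → ℕ → ℕ} (hf : Computable₂ f) {n : α → ℕ}
    (hn : Computable n) : Computable fun a => ∑ k ∈ Finset.range (n a), f a k := by
  refine (Computable.nat_rec (g := fun _ => 0)
    (h := fun a (p : ℕ × ℕ) => p.2 + f a p.1) hn (Computable.const 0) ?_).of_eq fun a => ?_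
  · exact (Primrec.nat_add.to_comp.comp (Computable.snd.comp Computable.snd)
      (hf.comp Computable.fst (Computable.fst.comp Computable.snd))).to₂
  · induction n a with
    | zero => rfl
    | succ k ih => rw [Finset.sum_range_succ, ← ih]

theorem computable_exists_lt {f : α → ℕ → Bool} (hf : Computable₂ f) {n : α → ℕ}
    (hn : Computable n) : Computable fun a => decide (∃ k < n a, f a k = true) := by
  have h1 : Computable₂ fun a k => bif f a k then some () else none :=
    Computable.cond hf (Computable.const _) (Computable.const _)
  refine (Primrec.option_isSome.to_comp.comp (computable_firstSome h1 hn)).of_eq fun a => ?_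
  rw [Bool.eq_iff_iff, decide_eq_true_iff]
  constructor
  · intro h
    obtain ⟨b, hb⟩ := Option.isSome_iff_exists.1 h
    obtain ⟨k, hk, hk'⟩ := exists_of_firstSome hb
    refine ⟨k, hk, ?_⟩
    by_contra hf
    rw [Bool.not_eq_true] at hf
    simp only [hf, cond_false] at hk'
    cases hk'
  · rintro ⟨k, hk, hk'⟩
    exact isSome_firstSome hk (b := ()) (by simp [hk'])

theorem computable_forall_lt {f : α → ℕ → Bool} (hf : Computable₂ f) {n : α → ℕ}
    (hn : Computable n) : Computable fun a => decide (∀ k < n a, f a k = true) := by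
  have h1 : Computable₂ fun a k => !f a k := Primrec.not.to_comp.comp hf
  refine (Primrec.not.to_comp.comp (computable_exists_lt h1 hn)).of_eq fun a => ?_
  rw [← decide_not]
  simp

theorem primrec_nat_pow : Primrec₂ ((· ^ ·) : ℕ → ℕ → ℕ) :=
  Primrec₂.unpaired'.1 Nat.Primrec.pow

theorem computable_two_pow {f : α → ℕ} (hf : Computable f) : Computable fun a => 2 ^ f a :=
  primrec_nat_pow.to_comp.comp (Computable.const 2) hf

theorem computable_decide_lt {f g : α → ℕ} (hf : Computable f) (hg : Computable g) :
    Computable fun a => decide (f a < g a) :=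
  Primrec.nat_lt.decide.to_comp.comp hf hg

theorem computable_decide_eq {γ : Type*} [Primcodable γ] [DecidableEq γ] {f g : α → γ}
    (hf : Computable f) (hg : Computable g) : Computable fun a => decide (f a = g a) :=
  Primrec.eq.decide.to_comp.comp hf hg

/-- Unbounded search; totality is guaranteed by `h`. -/
theorem exists_computable_choice {p : α → ℕ → Bool} (hp : Computable₂ p)
    (h : ∀ a, ∃ n, p a n = true) : ∃ u : α → ℕ, Computable u ∧ ∀ a, p a (u a) = true := by
  have h1 : ∀ a, ∃ n, n ∈ Nat.rfind fun n => (Part.some (p a n) : Part Bool) := fun a =>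
    Part.dom_iff_mem.1 <| Nat.rfind_dom.2 <| by
      obtain ⟨n, hn⟩ := h a
      exact ⟨n, by simpa using hn, fun _ => trivial⟩
  choose u hu using h1
  refine ⟨u, (Partrec.rfind hp.partrec₂).of_eq_tot hu, fun a => ?_⟩
  simpa using Nat.rfind_spec (hu a)

end Computability

/-! ### The strings of a given length -/

/-- The list of all strings of length `n`. -/
def strings (n : ℕ) : List (List Bool) :=
  Nat.rec [[]] (fun _ l => l.map (List.cons false) ++ l.map (List.cons true)) n

theorem strings_succ (n : ℕ) : strings (n + 1) =
    (strings n).map (List.cons false) ++ (strings n).map (List.cons true) := rfl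

theorem mem_strings {n : ℕ} {σ : List Bool} : σ ∈ strings n ↔ σ.length = n := by
  induction n generalizing σ with
  | zero => simp [strings]
  | succ n ih =>
    rw [strings_succ]
    cases σ with
    | nil => simp
    | cons b σ => cases b <;> simp [ih]

theorem nodup_strings (n : ℕ) : (strings n).Nodup := by
  induction n with
  | zero => simp [strings]
  | succ n ih =>
    rw [strings_succ, List.nodup_append]
    refine ⟨ih.map (List.cons_injective), ih.map (List.cons_injective), ?_⟩
    simp

theorem length_strings (n : ℕ) : (strings n).length = 2 ^ n := by
  induction n with
  | zero => rfl
  | succ n ih => rw [strings_succ]; simp [ih, pow_succ, mul_two]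

theorem computable_strings : Computable strings := by
  have : Primrec strings :=
    Primrec.nat_rec₁ _ <| Primrec.list_append.comp₂
      (Primrec.list_map Primrec.snd (Primrec.list_cons.comp (Primrec.const _) Primrec.snd).to₂).to₂
      (Primrec.list_map Primrec.snd (Primrec.list_cons.comp (Primrec.const _) Primrec.snd).to₂).to₂
  exact this.to_comp

/-! ### Effectively closed classes and computable trees -/

theorem take_restr (X : Cantor) {j s : ℕ} (h : j ≤ s) : (restr X s).take j = restr X j := by
  simpa using (List.prefix_iff_eq_take.1 (restr_prefix X h)).symm

theorem isPi01_of_tree {t : List Bool → Bool} (ht : Computable t) :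
    IsPi01 {X | ∀ s, t (restr X s) = true} := by
  refine ⟨{σ | t σ = false}, ?_, ?_⟩
  · refine (ComputablePred.computable_iff.2 ⟨fun σ => !t σ, Primrec.not.to_comp.comp ht, ?_⟩).to_re
    funext σ
    simp
  · ext X
    simp only [mem_compl_iff, mem_ofPred_eq, mem_iUnion, exists_prop, not_forall,
      Bool.not_eq_true]
    constructor
    · rintro ⟨s, hs⟩
      exact ⟨_, hs, mem_cylinder_restr X s⟩
    · rintro ⟨σ, hσ, hX⟩
      have h : restr X σ.length = σ := hX
      exact ⟨σ.length, by rwa [h]⟩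

/-- A string is rejected once one of its prefixes is seen to enter the c.e. set within a number of
steps bounded by its length. Rejection is permanent along `X`, so the clopen approximations decrease
and continuity from above applies. -/
theorem exists_tree {C : Set Cantor} (hC : IsPi01 C) : ∃ t : List Bool → Bool, Computable t ∧
    (∀ X, Antitone fun s => t (restr X s)) ∧ ∀ X, X ∈ C ↔ ∀ s, t (restr X s) = true := by
  obtain ⟨S, hS, hSC⟩ := hC
  obtain ⟨g, hg, hgS⟩ := exists_of_re hS
  have hC' : ∀ X, X ∈ C ↔ ¬ ∃ ρ ∈ S, X ∈ cylinder ρ := fun X => by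
    have : X ∈ Cᶜ ↔ ∃ ρ ∈ S, X ∈ cylinder ρ := by rw [hSC]; simp
    rw [← this]; simp
  -- `k` codes a prefix length and an enumeration stage. Since `k.unpair.1 ≤ k < σ.length`, `take`
  -- does return a prefix of that length.
  let p : List Bool → ℕ → Bool := fun σ k => !g (σ.take k.unpair.1) k.unpair.2
  have hp : Computable₂ p := Primrec.not.to_comp.comp <| hg.comp
    (Primrec.list_take.to_comp.comp (Computable.fst.comp (Computable.unpair.comp Computable.snd))
      Computable.fst) (Computable.snd.comp (Computable.unpair.comp Computable.snd))
  have key : ∀ X s, decide (∀ k < (restr X s).length, p (restr X s) k = true) = true ↔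
      ∀ k < s, g (restr X k.unpair.1) k.unpair.2 = false := by
    intro X s
    rw [decide_eq_true_iff, length_restr]
    refine forall₂_congr fun k hk => ?_
    have h : k.unpair.1 ≤ s := (Nat.unpair_left_le k).trans hk.le
    simp [p, take_restr X h]
  refine ⟨fun σ => decide (∀ k < σ.length, p σ k = true),
    computable_forall_lt hp Computable.list_length, fun X s s' hs => ?_, fun X => ?_⟩
  · refine Bool.le_iff_imp.2 fun h => ?_
    rw [key] at *
    exact fun k hk => h k (hk.trans_le hs)
  · simp only [key]
    rw [hC']
    constructor
    · intro h s k _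
      by_contra hk
      exact h ⟨_, (hgS _).2 ⟨_, by simpa using hk⟩, mem_cylinder_restr _ _⟩
    · rintro h ⟨ρ, hρ, hX⟩
      obtain ⟨m, hm⟩ := (hgS ρ).1 hρ
      have hX' : restr X ρ.length = ρ := hX
      have := h _ (Nat.pair ρ.length m) (Nat.lt_succ_self _)
      simp [hX', hm] at this

/-! ### Topology and measurability of cylinders -/

theorem isLocallyConstant_restr (s : ℕ) : IsLocallyConstant fun X : Cantor => restr X s := by
  rw [IsLocallyConstant.iff_eventually_eq]
  intro X
  have h : ∀ i ∈ Finset.range s, ∀ᶠ Y : Cantor in nhds X, Y i = X i := fun i _ =>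
    (continuous_apply i).continuousAt.eventually
      ((isOpen_discrete {X i}).mem_nhds rfl)
  filter_upwards [(Finset.eventually_all _).2 h] with Y hY
  exact List.map_congr_left fun i hi => hY i (by simpa using hi)

theorem isClopen_restr (p : List Bool → Prop) (s : ℕ) : IsClopen {X : Cantor | p (restr X s)} :=
  ⟨isOpen_compl_iff.1 (isLocallyConstant_restr s {σ | p σ}ᶜ), isLocallyConstant_restr s {σ | p σ}⟩

theorem isClopen_cylinder (σ : List Bool) : IsClopen (cylinder σ) :=
  isClopen_restr (fun τ => τ = σ) σ.length

theorem measurableSet_restr (p : List Bool → Prop) (s : ℕ) :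
    MeasurableSet {X : Cantor | p (restr X s)} := (isClopen_restr p s).isOpen.measurableSet

theorem measurableSet_cylinder (σ : List Bool) : MeasurableSet (cylinder σ) :=
  measurableSet_restr (fun τ => τ = σ) σ.length

theorem IsPi01.isClosed {C : Set Cantor} (hC : IsPi01 C) : IsClosed C := by
  obtain ⟨S, -, hS⟩ := hC
  rw [← isOpen_compl_iff, hS]
  exact isOpen_biUnion fun σ _ => (isClopen_cylinder σ).isOpen

theorem measurable_of_restr {F : Cantor → Cantor} {b : ℕ → List Bool → Bool} {u : ℕ → ℕ}
    (h : ∀ X n, F X n = b n (restr X (u n))) : Measurable F := by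
  refine measurable_pi_lambda _ fun n => measurable_to_bool ?_
  have : (fun X => F X n) ⁻¹' {true} = {X | b n (restr X (u n)) = true} := by
    ext X
    simp [h]
  rw [this]
  exact measurableSet_restr (fun σ => b n σ = true) (u n)

/-! ### Masses of clopen classes under computable measures -/

theorem restr_mem_cylinder {X : Cantor} {σ : List Bool} {s : ℕ} (h : σ.length = s) :
    X ∈ cylinder σ ↔ restr X s = σ := by
  subst h
  rfl

/-- The class is a disjoint union of cylinders of length `s`. Summing over list indices makes the
right side a bounded sum over `ℕ`; the default `[]` is never reached. -/
theorem measureReal_restr (μ : Measure Cantor) [IsFiniteMeasure μ] (p : List Bool → Bool) (s : ℕ) :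
    μ.real {X | p (restr X s) = true} = ∑ k ∈ Finset.range (2 ^ s),
      if p ((strings s).getD k []) = true then μ.real (cylinder ((strings s).getD k [])) else 0 := by
  have hl : ∀ k ∈ Finset.range (2 ^ s), ((strings s).getD k []).length = s := fun k hk => by
    have hk' : k < (strings s).length := by simpa [length_strings] using hk
    rw [List.getD_eq_getElem _ _ hk']
    exact mem_strings.1 (List.getElem_mem _)
  rw [← Finset.sum_filter, ← measureReal_biUnion_finset]
  · congr 1
    ext X
    simp only [mem_ofPred_eq, Finset.mem_filter, mem_iUnion, exists_prop]
    constructor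
    · intro h
      obtain ⟨k, hk, hk'⟩ := List.getElem_of_mem (mem_strings.2 (length_restr X s))
      refine ⟨k, ⟨by simpa [length_strings] using hk, ?_⟩, ?_⟩ <;>
        rw [List.getD_eq_getElem _ _ hk, hk']
      · exact h
      · exact mem_cylinder_restr X s
    · rintro ⟨k, ⟨hk, hp⟩, hX⟩
      rwa [(restr_mem_cylinder (hl k hk)).1 hX]
  · intro j hj k hk hjk
    simp only [Finset.coe_filter, mem_ofPred_eq] at hj hk
    refine Set.disjoint_left.2 fun X hX hX' => hjk ?_
    have h := ((restr_mem_cylinder (hl j hj.1)).1 hX).symm.trans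
      ((restr_mem_cylinder (hl k hk.1)).1 hX')
    have hj' : j < (strings s).length := by simpa [length_strings] using hj.1
    have hk' : k < (strings s).length := by simpa [length_strings] using hk.1
    rw [List.getD_eq_getElem _ _ hj', List.getD_eq_getElem _ _ hk'] at h
    exact (nodup_strings s).getElem_inj_iff.1 h
  · exact fun k _ => measurableSet_cylinder _

section

variable {α : Type*} [Primcodable α] {μ : Measure Cantor}

/-- Approximations with the denominator `2 ^ i`. -/
theorem IsComputableMeasure.exists_approx (hμ : IsComputableMeasure μ) :
    ∃ a : List Bool → ℕ → ℕ, Computable₂ a ∧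
      ∀ σ i, |μ.real (cylinder σ) - (a σ i : ℝ) / 2 ^ i| ≤ 2 * (2 : ℝ)⁻¹ ^ i := by
  obtain ⟨-, num, exp, hnum, hexp, h⟩ := hμ
  refine ⟨fun σ i => num σ i * 2 ^ i / 2 ^ exp σ i, ?_, fun σ i => ?_⟩
  · exact (Primrec.nat_div.to_comp.comp
      (Primrec.nat_mul.to_comp.comp hnum (computable_two_pow Computable.snd))
      (computable_two_pow hexp)).to₂
  · have h1 := h σ i
    -- Rounding down to a multiple of `2⁻ⁱ` costs at most another `2⁻ⁱ`, whence the factor 2 in the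
    -- bound.
    have h2 : |(num σ i : ℝ) / 2 ^ exp σ i -
        ((num σ i * 2 ^ i / 2 ^ exp σ i : ℕ) : ℝ) / 2 ^ i| ≤ (2 : ℝ)⁻¹ ^ i := by
      set q := num σ i * 2 ^ i / 2 ^ exp σ i with hq
      have e : (num σ i : ℝ) / 2 ^ exp σ i - (q : ℝ) / 2 ^ i =
          ((num σ i * 2 ^ i : ℕ) / (2 ^ exp σ i : ℕ) - (q : ℝ)) * (2 : ℝ)⁻¹ ^ i := by
        push_cast
        rw [inv_pow]
        field_simp
      have l1 : (q : ℝ) ≤ (num σ i * 2 ^ i : ℕ) / (2 ^ exp σ i : ℕ) := Nat.cast_div_le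
      have l2 : ((num σ i * 2 ^ i : ℕ) : ℝ) / (2 ^ exp σ i : ℕ) ≤ q + 1 := by
        rw [div_le_iff₀ (by positivity)]
        have := Nat.lt_div_mul_add (a := num σ i * 2 ^ i) (b := 2 ^ exp σ i) (by positivity)
        rw [← hq] at this
        have h3 : num σ i * 2 ^ i ≤ (q + 1) * 2 ^ exp σ i := by rw [add_mul]; omega
        exact_mod_cast h3
      rw [e, abs_of_nonneg (by have := sub_nonneg.2 l1; positivity)]
      exact mul_le_of_le_one_left (by positivity) (by linarith)
    have h3 := abs_sub_le (μ (cylinder σ)).toReal ((num σ i : ℝ) / 2 ^ exp σ i)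
      (((num σ i * 2 ^ i / 2 ^ exp σ i : ℕ) : ℝ) / 2 ^ i)
    change |(μ (cylinder σ)).toReal - _| ≤ _
    linarith

theorem IsComputableMeasure.exists_approx_restr (hμ : IsComputableMeasure μ)
    {P : α → List Bool → Bool} (hP : Computable₂ P) {s : α → ℕ} (hs : Computable s) :
    ∃ num exp : α → ℕ → ℕ, Computable₂ num ∧ Computable₂ exp ∧ ∀ x i,
      |μ.real {X | P x (restr X (s x)) = true} - (num x i : ℝ) / 2 ^ exp x i| ≤ (2 : ℝ)⁻¹ ^ i := by
  obtain ⟨a, ha, h⟩ := hμ.exists_approx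
  have := hμ.1
  let σ : α → ℕ → List Bool := fun x k => (strings (s x)).getD k []
  have hσ : Computable₂ σ := ((Primrec.list_getD []).to_comp.comp
    (computable_strings.comp (hs.comp Computable.fst)) Computable.snd).to₂
  have hexp : Computable₂ fun x i => i + s x + 1 := (Computable.succ.comp
    (Primrec.nat_add.to_comp.comp Computable.snd (hs.comp Computable.fst))).to₂
  -- There are `2 ^ s` cylinders, each with error at most `2 · 2^-(i+s+1)`, so the total error is at
  -- most `2⁻ⁱ`. The common denominator lets numerators be added as naturals.
  refine ⟨fun x i => ∑ k ∈ Finset.range (2 ^ s x),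
    bif P x (σ x k) then a (σ x k) (i + s x + 1) else 0, fun x i => i + s x + 1, ?_, hexp,
    fun x i => ?_⟩
  · refine computable_sum_range (α := α × ℕ) ?_ (computable_two_pow (hs.comp Computable.fst))
    have h1 : Computable fun p : (α × ℕ) × ℕ => σ p.1.1 p.2 :=
      hσ.comp (Computable.fst.comp Computable.fst) Computable.snd
    exact (Computable.cond (hP.comp (Computable.fst.comp Computable.fst) h1)
      (ha.comp h1 (hexp.comp (Computable.fst.comp Computable.fst)
        (Computable.snd.comp Computable.fst))) (Computable.const 0)).to₂
  · rw [measureReal_restr]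
    push_cast
    rw [Finset.sum_div, ← Finset.sum_sub_distrib]
    refine (Finset.abs_sum_le_sum_abs _ _).trans ?_
    refine (Finset.sum_le_card_nsmul _ _ (2 * (2 : ℝ)⁻¹ ^ (i + s x + 1)) fun k _ => ?_).trans ?_
    · change |(if P x (σ x k) = true then μ.real (cylinder (σ x k)) else 0) - _| ≤ _
      cases P x (σ x k) with
      | true => simpa using h (σ x k) (i + s x + 1)
      | false => simp
    · rw [Finset.card_range, nsmul_eq_mul, pow_add, pow_add]
      push_cast
      have : (2 : ℝ) ^ s x * (2 : ℝ)⁻¹ ^ s x = 1 := by rw [← mul_pow]; norm_num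
      refine le_of_eq ?_
      linear_combination (2 : ℝ)⁻¹ ^ i * this

/-- Comparison of a computable real with `2⁻ᵏ` is not decidable, so the test leaves a gap: an
approximation to within `2^-(k+2)` is compared with `2^-(k+1)`, which is right outside the interval
from `2^-(k+2)` to `2⁻ᵏ`. -/
theorem IsComputableMeasure.exists_test (hμ : IsComputableMeasure μ)
    {P : α → List Bool → Bool} (hP : Computable₂ P) {s k : α → ℕ} (hs : Computable s)
    (hk : Computable k) : ∃ q : α → Bool, Computable q ∧ ∀ x,
      (q x = true → μ.real {X | P x (restr X (s x)) = true} < (2 : ℝ)⁻¹ ^ k x) ∧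
      (μ.real {X | P x (restr X (s x)) = true} < (2 : ℝ)⁻¹ ^ (k x + 2) → q x = true) := by
  obtain ⟨num, exp, hnum, hexp, h⟩ := hμ.exists_approx_restr hP hs
  have hk2 : Computable fun x => k x + 2 := Computable.succ.comp (Computable.succ.comp hk)
  refine ⟨fun x => decide (num x (k x + 2) * 2 ^ (k x + 1) < 2 ^ exp x (k x + 2)),
    computable_decide_lt
      (Primrec.nat_mul.to_comp.comp (hnum.comp Computable.id hk2)
        (computable_two_pow (Computable.succ.comp hk)))
      (computable_two_pow (hexp.comp Computable.id hk2)), fun x => ?_⟩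
  have h1 := abs_le.1 (h x (k x + 2))
  have h2 : num x (k x + 2) * 2 ^ (k x + 1) < 2 ^ exp x (k x + 2) ↔
      (num x (k x + 2) : ℝ) / 2 ^ exp x (k x + 2) < (2 : ℝ)⁻¹ ^ (k x + 1) := by
    rw [div_lt_iff₀ (by positivity), inv_pow, ← div_eq_inv_mul, lt_div_iff₀ (by positivity)]
    exact_mod_cast Iff.rfl
  rw [decide_eq_true_iff, h2]
  have h3 : (0 : ℝ) < (2 : ℝ)⁻¹ ^ k x := by positivity
  simp only [pow_add] at *
  constructor <;> intro h4 <;> linarith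

/-- Search for a stage that passes the test. The search ends because the masses eventually drop
below `2^-(k+2)`, where the test must succeed. -/
theorem IsComputableMeasure.exists_stage (hμ : IsComputableMeasure μ)
    {P : α → List Bool → Bool} (hP : Computable₂ P) {k : α → ℕ} (hk : Computable k)
    (hlim : ∀ x, Tendsto (fun s => μ {X | P x (restr X s) = true}) atTop (nhds 0)) :
    ∃ u : α → ℕ, Computable u ∧
      ∀ x, μ {X | P x (restr X (u x)) = true} < (2 : ℝ≥0∞)⁻¹ ^ k x := by
  have := hμ.1
  obtain ⟨q, hq, h⟩ := hμ.exists_test (α := α × ℕ) (P := fun x => P x.1)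
    (hP.comp (Computable.fst.comp Computable.fst) Computable.snd).to₂ Computable.snd
    (hk.comp Computable.fst)
  have toReal : ∀ (S : Set Cantor) (n : ℕ), μ S < (2 : ℝ≥0∞)⁻¹ ^ n ↔ μ.real S < (2 : ℝ)⁻¹ ^ n := by
    intro S n
    rw [measureReal_def, ← ENNReal.toReal_lt_toReal (measure_ne_top _ _) (by simp)]
    simp
  obtain ⟨u, hu, hu'⟩ := exists_computable_choice (p := fun x n => q (x, n)) hq.to₂ fun x => by
    obtain ⟨n, hn⟩ := ((hlim x).eventually_lt_const
      (u := (2 : ℝ≥0∞)⁻¹ ^ (k x + 2)) (by simp [ENNReal.pow_pos])).exists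
    exact ⟨n, (h (x, n)).2 ((toReal _ _).1 hn)⟩
  exact ⟨u, hu, fun x => (toReal _ _).2 ((h (x, u x)).1 (hu' x))⟩

/-- When the use of `F` is computably bounded, as for tt-functionals, the preimage of a cylinder is
a clopen class found effectively, and its mass can be approximated. -/
theorem IsComputableMeasure.map (hμ : IsComputableMeasure μ) {F : Cantor → Cantor}
    (hF : Measurable F) {P : List Bool → List Bool → Bool} (hP : Computable₂ P)
    {U : List Bool → ℕ} (hU : Computable U)
    (h : ∀ τ X, F X ∈ cylinder τ ↔ P τ (restr X (U τ)) = true) :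
    IsComputableMeasure (μ.map F) := by
  have := hμ.1
  obtain ⟨num, exp, hnum, hexp, h'⟩ := hμ.exists_approx_restr hP hU
  refine ⟨inferInstance, num, exp, hnum, hexp, fun τ i => ?_⟩
  rw [Measure.map_apply hF (measurableSet_cylinder τ)]
  have : F ⁻¹' cylinder τ = {X | P τ (restr X (U τ)) = true} := Set.ext fun X => h τ X
  rw [this]
  exact h' τ i

end

/-! ### tt-depth and tt-negligibility -/

theorem measure_le_stringMass (μ : Measure Cantor) (C : Set Cantor) (n : ℕ) :
    μ C ≤ stringMass μ (treeLevel (canonicalTree C) n) := by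
  refine (measure_mono fun X hX => ?_).trans (measure_iUnion_le _)
  exact mem_iUnion.2 ⟨⟨restr X n, ⟨X, mem_cylinder_restr X n, hX⟩, length_restr X n⟩,
    mem_cylinder_restr X n⟩

/-- The canonical tree is only co-c.e.; this replaces its levels by those of a computable tree
containing it. -/
theorem stringMass_le (μ : Measure Cantor) {C : Set Cantor} {p : List Bool → Prop} {n : ℕ}
    (h : ∀ X ∈ C, p (restr X n)) :
    stringMass μ (treeLevel (canonicalTree C) n) ≤ μ {X | p (restr X n)} := by
  rw [stringMass, ← measure_iUnion]
  · refine measure_mono fun X hX => ?_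
    obtain ⟨⟨σ, ⟨Y, hY, hYC⟩, hσ⟩, hX⟩ := mem_iUnion.1 hX
    have hX' := (restr_mem_cylinder hσ).1 hX
    have hY' := (restr_mem_cylinder hσ).1 hY
    change p (restr X n)
    rw [hX', ← hY']
    exact h Y hYC
  · rintro ⟨σ, _, hσ⟩ ⟨τ, _, hτ⟩ hne
    refine Set.disjoint_left.2 fun X hX hX' => hne (Subtype.ext ?_)
    exact ((restr_mem_cylinder hσ).1 hX).symm.trans ((restr_mem_cylinder hτ).1 hX')
  · exact fun σ => measurableSet_cylinder _

theorem TTDeep.ttNegligible {C : Set Cantor} (hC : TTDeep C) : TTNegligible C := by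
  intro μ hμ
  obtain ⟨h, ⟨-, hmono, hunb⟩, hh⟩ := hC μ hμ
  obtain ⟨N, hN⟩ := eventually_atTop.1 hh
  by_contra h0
  obtain ⟨k, hk⟩ := ((ENNReal.tendsto_pow_atTop_nhds_zero_of_lt_one
    (r := (2 : ℝ≥0∞)⁻¹) (by norm_num)).eventually_lt_const (pos_iff_ne_zero.2 h0)).exists
  obtain ⟨n, hn⟩ := hunb k
  -- Beyond `N` the depth bound is valid, and beyond `n` the order is at least `k`.
  have h1 := (measure_le_stringMass μ C (max n N)).trans_lt (hN _ (le_max_right _ _))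
  have h2 : (2 : ℝ≥0∞)⁻¹ ^ h (max n N) ≤ (2 : ℝ≥0∞)⁻¹ ^ k :=
    pow_le_pow_right_of_le_one' (by norm_num) (hn.trans (hmono (le_max_left _ _)))
  exact absurd (h1.trans_le h2) hk.not_gt

theorem tendsto_measure_restr (μ : Measure Cantor) [IsFiniteMeasure μ] {p : List Bool → Bool}
    (hp : ∀ X, Antitone fun s => p (restr X s)) (h0 : μ {X | ∀ s, p (restr X s) = true} = 0) :
    Tendsto (fun s => μ {X | p (restr X s) = true}) atTop (nhds 0) := by
  have h : {X | ∀ s, p (restr X s) = true} = ⋂ s, {X | p (restr X s) = true} := by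
    ext X
    simp
  rw [← h0, h]
  refine tendsto_measure_iInter_atTop
    (fun s => (measurableSet_restr (fun σ => p σ = true) s).nullMeasurableSet)
    (fun s s' hs X hX => Bool.le_iff_imp.1 (hp X hs) hX) ⟨0, measure_ne_top _ _⟩

/-- Every computable function has a slow computable inverse. -/
theorem exists_computableOrder {g : ℕ → ℕ} (hg : Computable g) :
    ∃ h : ℕ → ℕ, IsComputableOrder h ∧ ∀ᶠ n in atTop, g (h n) ≤ n := by
  -- `h` moves from `k` to `k + 1` at step `n + 1` only if `g (k + 1) ≤ n + 1`, so `g (h n) ≤ n`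
  -- once `h` has left 0, without monotonicity of `g`. The initial value 0 is never tested, hence
  -- the threshold `g 0` below.
  let h : ℕ → ℕ := fun n =>
    Nat.rec 0 (fun n k => bif decide (g (k + 1) < n + 2) then k + 1 else k) n
  have hs : ∀ n, h (n + 1) = if g (h n + 1) < n + 2 then h n + 1 else h n := fun n => by
    change (bif decide (g (h n + 1) < n + 2) then h n + 1 else h n) = _
    rw [cond_eq_ite]
    simp
  have hmono : Monotone h := monotone_nat_of_le_succ fun n => by
    rw [hs]
    split_ifs <;> omega
  refine ⟨h, ⟨?_, hmono, fun k => ?_⟩, eventually_atTop.2 ⟨g 0, fun n hn => ?_⟩⟩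
  · have h1 : Computable fun p : ℕ × ℕ × ℕ => p.2.2 + 1 :=
      Computable.succ.comp (Computable.snd.comp Computable.snd)
    exact Computable.nat_rec Computable.id (Computable.const 0) (Computable.cond
      (computable_decide_lt (hg.comp h1)
        (Computable.succ.comp (Computable.succ.comp (Computable.fst.comp Computable.snd))))
      h1 (Computable.snd.comp Computable.snd)).to₂
  · induction k with
    | zero => exact ⟨0, Nat.zero_le _⟩
    | succ k ih =>
      obtain ⟨n, hn⟩ := ih
      rcases hn.lt_or_eq with hn | hn
      · exact ⟨n, hn⟩
      -- By this time either `h` has already passed `k`, or it equals `k` and the test for `k + 1`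
      -- succeeds.
      · refine ⟨max n (g (k + 1)) + 1, ?_⟩
        have h1 : k ≤ h (max n (g (k + 1))) := hn.le.trans (hmono (le_max_left _ _))
        rw [hs]
        rcases h1.lt_or_eq with h2 | h2
        · split_ifs <;> omega
        · rw [← h2, if_pos]
          have := le_max_right n (g (k + 1))
          omega
  · have key : ∀ n, h n = 0 ∨ g (h n) ≤ n := fun n => by
      induction n with
      | zero => exact Or.inl rfl
      | succ n ih =>
        rw [hs]
        split_ifs with hc
        · exact Or.inr (by omega)
        · exact ih.imp id fun h => by omega
    rcases key n with h0 | h0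
    · rwa [h0]
    · exact h0

theorem IsPi01.ttDeep {C : Set Cantor} (hC : IsPi01 C) (h : TTNegligible C) : TTDeep C := by
  intro μ hμ
  have := hμ.1
  obtain ⟨t, ht, hmono, htC⟩ := exists_tree hC
  have hCt : C = {X | ∀ s, t (restr X s) = true} := Set.ext htC
  obtain ⟨g, hg, hgμ⟩ := hμ.exists_stage (P := fun _ : ℕ => t) (ht.comp Computable.snd).to₂
    Computable.id fun _ => tendsto_measure_restr μ hmono (by rw [← hCt]; exact h μ hμ)
  obtain ⟨f, hf, hfg⟩ := exists_computableOrder hg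
  refine ⟨f, hf, hfg.mono fun n hn => ?_⟩
  refine (stringMass_le μ (p := fun σ => t σ = true) fun X hX => (htC X).1 hX n).trans_lt ?_
  -- Since `g (f n) ≤ n`, level `n` of the tree lies inside its approximation at stage `g (f n)`, of
  -- mass below `2^-(f n)`.
  exact (measure_mono fun X hX => Bool.le_iff_imp.1 (hmono X hn) hX).trans_lt (hgμ (f n))

theorem IsPi01.ttDeep_iff {C : Set Cantor} (hC : IsPi01 C) : TTDeep C ↔ TTNegligible C :=
  ⟨TTDeep.ttNegligible, hC.ttDeep⟩

/-! ### Stages of a Turing functional -/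

namespace TuringFunctional

/-- `B n σ` is the `n`-th output bit found by a search of length `σ.length` that reads only `σ`.
Each candidate in the search depends on a fixed prefix of `X`, so the first hit is never revised as
more of `X` is read. -/
theorem exists_stages (Φ : TuringFunctional) : ∃ B : ℕ → List Bool → Option Bool, Computable₂ B ∧
    (∀ X n s s' b, s ≤ s' → B n (restr X s) = some b → B n (restr X s') = some b) ∧
    (∀ X n s b, B n (restr X s) = some b → ∃ τ ∈ Φ.outputs X, τ[n]? = some b) ∧
    ∀ X n, (∃ τ ∈ Φ.outputs X, n < τ.length) → ∃ s, (B n (restr X s)).isSome := by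
  obtain ⟨f, hf, hfΦ⟩ := exists_of_re Φ.re
  -- `k` codes an input prefix length, an output string, and a stage at which the pair is to appear
  -- in the graph.
  let h : ℕ × List Bool → ℕ → Option Bool := fun p k =>
    (Encodable.decode (α := List Bool × ℕ) k.unpair.2).bind fun q =>
      bif f (p.2.take k.unpair.1, q.1) q.2 then q.1[p.1]? else none
  have hh : Computable₂ h := by
    refine Computable.option_bind (Computable.decode.comp
      (Computable.snd.comp (Computable.unpair.comp Computable.snd))) ?_
    have h1 : Computable fun x : ((ℕ × List Bool) × ℕ) × (List Bool × ℕ) =>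
        x.1.1.2.take x.1.2.unpair.1 :=
      Primrec.list_take.to_comp.comp
        (Computable.fst.comp (Computable.unpair.comp (Computable.snd.comp Computable.fst)))
        (Computable.snd.comp (Computable.fst.comp Computable.fst))
    exact (Computable.cond
      (hf.comp (h1.pair (Computable.fst.comp Computable.snd)) (Computable.snd.comp Computable.snd))
      (Computable.list_getElem?.comp (Computable.fst.comp Computable.snd)
        (Computable.fst.comp (Computable.fst.comp Computable.fst)))
      (Computable.const none)).to₂
  have hX : ∀ X n s k, k < s → h (n, restr X s) k =
      (Encodable.decode (α := List Bool × ℕ) k.unpair.2).bind fun q =>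
        bif f (restr X k.unpair.1, q.1) q.2 then q.1[n]? else none := by
    intro X n s k hk
    have : k.unpair.1 ≤ s := (Nat.unpair_left_le k).trans hk.le
    simp [h, take_restr X this]
  refine ⟨fun n σ => firstSome (h (n, σ)) σ.length,
    (computable_firstSome hh (Computable.list_length.comp Computable.snd)).to₂, ?_, ?_, ?_⟩
  · intro X n s s' b hs hb
    simp only [length_restr] at *
    refine firstSome_mono hs ?_
    rw [← hb]
    exact firstSome_congr fun k hk => by rw [hX X n s' k (hk.trans_le hs), hX X n s k hk]
  · intro X n s b hb
    obtain ⟨k, hk, hk'⟩ := exists_of_firstSome hb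
    rw [length_restr] at hk
    rw [hX X n s k hk, Option.bind_eq_some_iff] at hk'
    obtain ⟨⟨τ, m⟩, -, hq⟩ := hk'
    cases hfm : f (restr X k.unpair.1, τ) m with
    | false => simp [hfm] at hq
    | true => exact ⟨τ, ⟨_, (hfΦ _).2 ⟨m, hfm⟩⟩, by simpa [hfm] using hq⟩
  · rintro X n ⟨τ, ⟨j, hj⟩, hn⟩
    obtain ⟨m, hm⟩ := (hfΦ _).1 hj
    let k := Nat.pair j (Encodable.encode (τ, m))
    refine ⟨k + 1, isSome_firstSome (k := k) (b := τ[n]) (by simp) ?_⟩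
    rw [hX X n (k + 1) k k.lt_succ_self]
    simp only [k, Nat.unpair_pair, Encodable.encodek, Option.bind_some, hm, cond_true]
    exact List.getElem?_eq_getElem hn

theorem countable : Countable TuringFunctional := by
  have h : ∀ Φ : TuringFunctional, ∃ c : Nat.Partrec.Code,
      ∀ p, p ∈ Φ.graph ↔ (c.eval (Encodable.encode p)).Dom := fun Φ => by
    obtain ⟨c, hc⟩ := Nat.Partrec.Code.exists_code.1 Φ.re
    refine ⟨c, fun p => ?_⟩
    rw [hc]
    simp [Part.assert]
  choose c hc using h
  have hinj : Function.Injective c := fun Φ Ψ h => by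
    have : Φ.graph = Ψ.graph := Set.ext fun p => by rw [hc, hc, h]
    cases Φ
    cases Ψ
    simpa using this
  exact hinj.countable

end TuringFunctional

/-! ### Muchnik reducibility and tt-negligibility -/

theorem IsPi01.inter_cylinder {D : Set Cantor} (hD : IsPi01 D) (ρ : List Bool) :
    IsPi01 (D ∩ cylinder ρ) := by
  obtain ⟨t, ht, -, htD⟩ := exists_tree hD
  -- The tree constrains only the strings of length exactly `ρ.length`; all other lengths pass the
  -- second test.
  convert isPi01_of_tree (t := fun σ => t σ && (!decide (σ.length = ρ.length) || decide (σ = ρ)))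
    ?_ using 1
  · ext X
    simp only [mem_inter_iff, htD, mem_ofPred_eq, Bool.and_eq_true, forall_and]
    refine and_congr_right fun _ => ?_
    simp [← imp_iff_not_or, cylinder]
  · exact Primrec.and.to_comp.comp ht (Primrec.or.to_comp.comp
      (Primrec.not.to_comp.comp
        (computable_decide_eq Computable.list_length (Computable.const ρ.length)))
      (computable_decide_eq Computable.id (Computable.const ρ)))

/-- Closed classes contain the value of a functional whose outputs all meet the class. -/
theorem eval_mem_of_outputs {C : Set Cantor} (hC : IsClosed C) {Φ : TuringFunctional} {X : Cantor}
    (hX : X ∈ Φ.dom) (h : ∀ τ ∈ Φ.outputs X, (cylinder τ ∩ C).Nonempty) : Φ.eval X ∈ C := by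
  by_contra hc
  obtain ⟨n, hn⟩ : ∃ n, ∀ Y ∈ C, restr Y n ≠ restr (Φ.eval X) n := by
    by_contra! H
    choose Y hYC hY using H
    refine hc (hC.mem_of_tendsto (f := Y) (b := atTop) ?_ (Eventually.of_forall hYC))
    rw [tendsto_pi_nhds]
    intro i
    refine tendsto_const_nhds.congr' ?_
    filter_upwards [eventually_gt_atTop i] with n hn
    have := congrArg (fun σ : List Bool => σ[i]?) (hY n)
    simp only [(getElem?_restr (Y n) n i (Y n i)).2 ⟨hn, rfl⟩,
      (getElem?_restr (Φ.eval X) n i (Φ.eval X i)).2 ⟨hn, rfl⟩] at this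
    exact (Option.some_injective _ this).symm
  obtain ⟨τ, hτ, hl⟩ := hX n
  obtain ⟨Y, hY, hYC⟩ := h τ hτ
  refine hn Y hYC ?_
  have h1 : restr Y τ.length = τ := hY
  have h2 : restr (Φ.eval X) τ.length = τ := Φ.eval_mem_cylinder hτ
  rw [← take_restr Y hl, ← take_restr (Φ.eval X) hl, h1, h2]

/-- If a computable functional, given by its stages `B`, is almost everywhere defined on an
effectively closed class of positive measure, then it agrees there, on a set of positive measure,
with a total function whose image measure is computable. -/
theorem exists_total {μ : Measure Cantor} (hμ : IsComputableMeasure μ)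
    {D : Set Cantor} (hD : IsPi01 D) (hpos : μ D ≠ 0) {B : ℕ → List Bool → Option Bool}
    (hB : Computable₂ B)
    (hmono : ∀ X n s s' b, s ≤ s' → B n (restr X s) = some b → B n (restr X s') = some b)
    (hdef : ∀ n, μ (D ∩ {X | ∀ s, B n (restr X s) = none}) = 0) :
    ∃ F : Cantor → Cantor, Measurable F ∧ IsComputableMeasure (μ.map F) ∧
      μ (D ∩ {X | ∀ n, ∃ s, B n (restr X s) = some (F X n)}) ≠ 0 := by
  have := hμ.1
  obtain ⟨t, ht, htm, htD⟩ := exists_tree hD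
  -- `2^-K < μ D` is the total error allowed; bit `n` gets the share `2^-(K+n+1)`.
  obtain ⟨K, hK⟩ := ((ENNReal.tendsto_pow_atTop_nhds_zero_of_lt_one
    (r := (2 : ℝ≥0∞)⁻¹) (by norm_num)).eventually_lt_const (pos_iff_ne_zero.2 hpos)).exists
  -- `P n` holds while `X` still looks like a member of `D` and bit `n` has not been output. In the
  -- limit this is the null class of `hdef n`, so a stage `u n` with small mass can be computed.
  let P : ℕ → List Bool → Bool := fun n σ => t σ && !(B n σ).isSome
  have hP : Computable₂ P := (Primrec.and.to_comp.comp (ht.comp Computable.snd)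
    (Primrec.not.to_comp.comp (Primrec.option_isSome.to_comp.comp hB))).to₂
  have hPm : ∀ n X, Antitone fun s => P n (restr X s) := fun n X s s' hs =>
    Bool.le_iff_imp.2 fun h => by
      simp only [P, Bool.and_eq_true, Bool.not_eq_true', Option.isSome_eq_false_iff,
        Option.isNone_iff_eq_none] at *
      refine ⟨Bool.le_iff_imp.1 (htm X hs) h.1, Option.eq_none_iff_forall_ne_some.2 fun b hb => ?_⟩
      rw [hmono X n s s' b hs hb] at h
      cases h.2
  obtain ⟨u, hu, hμu⟩ := hμ.exists_stage hP
    (k := fun n => K + (n + 1)) (Primrec.nat_add.to_comp.comp (Computable.const K) Computable.succ)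
    fun n => tendsto_measure_restr μ (hPm n) (by
      convert hdef n using 2
      ext X
      simp [P, htD, forall_and])
  -- The default `false` makes `F` total. On `D` it is used only inside the exceptional sets whose
  -- masses were just bounded.
  let F : Cantor → Cantor := fun X n => (B n (restr X (u n))).getD false
  have hF : Measurable F := measurable_of_restr (b := fun n σ => (B n σ).getD false)
    (u := u) fun X n => rfl
  refine ⟨F, hF, ?_, fun h0 => ?_⟩
  -- The sum serves as a computable upper bound for the stages `u i` with `i < τ.length`.
  · let U : List Bool → ℕ := fun τ => ∑ i ∈ Finset.range τ.length, u i
    have hU : Computable U := computable_sum_range (hu.comp Computable.snd).to₂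
      Computable.list_length
    let f : List Bool × List Bool → ℕ → Bool := fun p i =>
      decide (some ((B i (p.2.take (u i))).getD false) = p.1[i]?)
    have hf : Computable₂ f := computable_decide_eq
      (Computable.option_some.comp (Computable.option_getD
        (hB.comp Computable.snd (Primrec.list_take.to_comp.comp (hu.comp Computable.snd)
          (Computable.snd.comp Computable.fst))) (Computable.const false)))
      (Computable.list_getElem?.comp (Computable.fst.comp Computable.fst) Computable.snd)
    refine hμ.map hF (P := fun τ σ => decide (∀ i < τ.length, f (τ, σ) i = true))
      (computable_forall_lt hf (Computable.list_length.comp Computable.fst)).to₂ hU fun τ X => ?_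
    have hle : ∀ i < τ.length, u i ≤ U τ := fun i hi =>
      Finset.single_le_sum (f := u) (fun _ _ => Nat.zero_le _) (Finset.mem_range.2 hi)
    rw [decide_eq_true_iff, mem_cylinder_iff]
    constructor
    · intro h i hi
      have := h i _ (List.getElem?_eq_getElem hi)
      simp only [f, decide_eq_true_eq, take_restr X (hle i hi)]
      rw [List.getElem?_eq_getElem hi, ← this]
    · intro h i b hb
      obtain ⟨hi, -⟩ := List.getElem?_eq_some_iff.1 hb
      have := h i hi
      simp only [f, decide_eq_true_eq, take_restr X (hle i hi), hb] at this
      exact Option.some_injective _ this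
  -- If `F` were wrong almost everywhere on `D`, the exceptional sets alone would cover `D` up to a
  -- null set, giving `μ D ≤ 2^-K`.
  · have hcover : D ⊆ (D ∩ {X | ∀ n, ∃ s, B n (restr X s) = some (F X n)}) ∪
        ⋃ n, {X | P n (restr X (u n)) = true} := by
      intro X hX
      by_cases h : ∃ n, P n (restr X (u n)) = true
      · exact Or.inr (mem_iUnion.2 h)
      · refine Or.inl ⟨hX, fun n => ⟨u n, ?_⟩⟩
        have h1 : (B n (restr X (u n))).isSome := by
          by_contra h2
          exact h ⟨n, by simp [P, (htD X).1 hX (u n), Option.not_isSome_iff_eq_none.1 h2]⟩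
        obtain ⟨b, hb⟩ := Option.isSome_iff_exists.1 h1
        simp [F, hb]
    have h1 : μ D ≤ ∑' n : ℕ, (2 : ℝ≥0∞)⁻¹ ^ (K + (n + 1)) :=
      (measure_mono hcover).trans <| (measure_union_le _ _).trans <| by
        rw [h0, zero_add]
        exact (measure_iUnion_le _).trans (ENNReal.tsum_le_tsum fun n => (hμu n).le)
    have h2 : ∑' n : ℕ, (2 : ℝ≥0∞)⁻¹ ^ (K + (n + 1)) = (2 : ℝ≥0∞)⁻¹ ^ K := by
      simp_rw [pow_add (2 : ℝ≥0∞)⁻¹ K]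
      rw [ENNReal.tsum_mul_left, ENNReal.tsum_geometric_add_one]
      rw [ENNReal.one_sub_inv_two, inv_inv, ENNReal.inv_mul_cancel (by simp) (by simp), mul_one]
    rw [h2] at h1
    exact absurd hK h1.not_gt

/-- `Φ` can fail on a set of positive measure in two ways, each cutting out a `Π⁰₁` subclass: by an
output that no member of `C` extends, or by an output bit that is never produced. If neither
happens, the image measure of `exists_total` charges `C`. The case distinction need not be
effective, as `μ` stays fixed. -/
theorem exists_subclass {μ : Measure Cantor} (hμ : IsComputableMeasure μ) {C D : Set Cantor}
    (hC : IsPi01 C) (hneg : TTNegligible C) (hD : IsPi01 D) (hpos : μ D ≠ 0)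
    (Φ : TuringFunctional) : ∃ E ⊆ D, IsPi01 E ∧ μ E ≠ 0 ∧ ∀ X ∈ E, X ∈ Φ.dom → Φ.eval X ∉ C := by
  obtain ⟨B, hB, hmono, hsound, hcomplete⟩ := Φ.exists_stages
  by_cases hV : ∃ p ∈ Φ.graph, cylinder p.2 ∩ C = ∅ ∧ μ (D ∩ cylinder p.1) ≠ 0
  · obtain ⟨⟨σ, τ⟩, hp, hτ, hσ⟩ := hV
    refine ⟨_, inter_subset_left, hD.inter_cylinder σ, hσ, fun X hX _ hXC => ?_⟩
    have hX' : restr X σ.length = σ := hX.2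
    have h1 : Φ.eval X ∈ cylinder τ := Φ.eval_mem_cylinder ⟨σ.length, by rwa [hX']⟩
    exact (hτ ▸ (⟨h1, hXC⟩ : Φ.eval X ∈ cylinder τ ∩ C) : Φ.eval X ∈ (∅ : Set Cantor))
  by_cases hW : ∃ n, μ (D ∩ {X | ∀ s, B n (restr X s) = none}) ≠ 0
  · obtain ⟨n, hn⟩ := hW
    refine ⟨_, inter_subset_left, ?_, hn, fun X hX hdom _ => ?_⟩
    · obtain ⟨t, ht, -, htD⟩ := exists_tree hD
      convert isPi01_of_tree (t := fun σ => t σ && !(B n σ).isSome)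
        (Primrec.and.to_comp.comp ht (Primrec.not.to_comp.comp (Primrec.option_isSome.to_comp.comp
          (hB.comp (Computable.const n) Computable.id)))) using 1
      ext X
      simp [htD, forall_and]
    · obtain ⟨s, hs⟩ := hcomplete X n (hdom (n + 1))
      simp [hX.2 s] at hs
  · push Not at hV hW
    exfalso
    obtain ⟨F, hF, hFμ, hFD⟩ := exists_total hμ hD hpos hB hmono hW
    have h1 : μ (F ⁻¹' C) = 0 := by
      rw [← Measure.map_apply hF hC.isClosed.measurableSet]
      exact hneg _ hFμ
    -- The graph is countable, so the inputs in `D` with some output incompatible with `C` form a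
    -- null set.
    have h2 : μ (⋃ p ∈ {p ∈ Φ.graph | cylinder p.2 ∩ C = ∅}, D ∩ cylinder p.1) = 0 :=
      (measure_biUnion_null_iff (Set.to_countable _)).2 fun p hp => hV p hp.1 hp.2
    -- Where `F` agrees with the stages of `Φ`, it equals `Φ.eval`; so either some output misses
    -- `C`, or closedness of `C` puts `F X` into `C`.
    refine hFD (measure_mono_null (fun X hX => ?_) (measure_union_null h1 h2))
    by_cases hXV : ∃ τ ∈ Φ.outputs X, cylinder τ ∩ C = ∅
    · obtain ⟨τ, ⟨n, hn⟩, hτ⟩ := hXV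
      exact Or.inr (mem_biUnion (x := (restr X n, τ)) ⟨hn, hτ⟩ ⟨hX.1, mem_cylinder_restr X n⟩)
    · refine Or.inl ?_
      push Not at hXV
      have h3 : ∀ n, ∃ τ ∈ Φ.outputs X, τ[n]? = some (F X n) := fun n => by
        obtain ⟨s, hs⟩ := hX.2 n
        exact hsound X n s _ hs
      have hdom : X ∈ Φ.dom := fun n => by
        obtain ⟨τ, hτ, h⟩ := h3 n
        exact ⟨τ, hτ, (List.getElem?_eq_some_iff.1 h).1.le⟩
      have heq : Φ.eval X = F X := funext fun n => by
        obtain ⟨τ, hτ, h⟩ := h3 n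
        exact (mem_cylinder_iff _ _).1 (Φ.eval_mem_cylinder hτ) n _ h
      rw [mem_preimage, ← heq]
      exact eval_mem_of_outputs hC.isClosed hdom hXV

theorem MuchnikLE.ttNegligible {C D : Pi01Class} (h : MuchnikLE C D)
    (hC : TTNegligible C.carrier) : TTNegligible D.carrier := by
  intro μ hμ
  by_contra hpos
  have := TuringFunctional.countable
  -- A surjection from `ℕ` needs an inhabited target; positive measure provides a point of `D`, and
  -- the reduction provides a functional for it.
  have : Nonempty TuringFunctional := by
    obtain ⟨X, hX⟩ := nonempty_of_measure_ne_zero hpos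
    obtain ⟨Φ, -⟩ := h X hX
    exact ⟨Φ⟩
  obtain ⟨e, he⟩ := exists_surjective_nat TuringFunctional
  let S := {E : Set Cantor // IsPi01 E ∧ μ E ≠ 0}
  have step : ∀ (n : ℕ) (E : S), ∃ E' : S, E'.1 ⊆ E.1 ∧
      ∀ X ∈ E'.1, X ∈ (e n).dom → (e n).eval X ∉ C.carrier := fun n E => by
    obtain ⟨E', h1, h2, h3, h4⟩ := exists_subclass hμ C.isPi01 hC E.2.1 E.2.2 (e n)
    exact ⟨⟨E', h2, h3⟩, h1, h4⟩
  choose f hfsub hf using step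
  let E : ℕ → S := fun n => Nat.rec ⟨D.carrier, D.isPi01, hpos⟩ f n
  -- A common point of the nested nonempty closed classes defeats every `e n`, because it lies in `E
  -- (n + 1)`.
  obtain ⟨X, hX⟩ := IsCompact.nonempty_iInter_of_sequence_nonempty_isCompact_isClosed
    (fun n => (E n).1) (fun n => hfsub n (E n)) (fun n => nonempty_of_measure_ne_zero (E n).2.2)
    (E 0).2.1.isClosed.isCompact fun n => (E n).2.1.isClosed
  rw [mem_iInter] at hX
  obtain ⟨Φ, hdom, hmem⟩ := h X (hX 0)
  obtain ⟨n, rfl⟩ := he Φ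
  exact hf n (E n) X (hX (n + 1)) hdom hmem

theorem MedvedevLE.muchnikLE {C D : Pi01Class} (h : MedvedevLE C D) : MuchnikLE C D := by
  obtain ⟨Φ, h1, h2⟩ := h
  exact fun X hX => ⟨Φ, h1 hX, h2 ⟨X, hX, rfl⟩⟩

/-! ### Infima of tt-negligible classes -/

/-- The shift has bounded use, so the image of `μ` under it is computable and is null on both `C`
and `D`. Their preimages cover the infimum. -/
theorem TTNegligible.infSet {C D : Set Cantor} (hC : TTNegligible C) (hD : TTNegligible D) :
    TTNegligible (infSet C D) := by
  intro μ hμ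
  let F : Cantor → Cantor := fun X n => X (n + 1)
  have hF : Measurable F := measurable_pi_lambda _ fun n => measurable_pi_apply (n + 1)
  have hFμ : IsComputableMeasure (μ.map F) := by
    refine hμ.map hF (P := fun τ σ => decide (σ.tail = τ)) (U := fun τ => τ.length + 1)
      (computable_decide_eq (Primrec.list_tail.to_comp.comp Computable.snd) Computable.fst).to₂
      (Computable.succ.comp Computable.list_length) fun τ X => ?_
    rw [decide_eq_true_iff]
    conv_rhs => rw [← consSeq_eta X, restr_consSeq]
    rfl
  refine measure_mono_null ?_ (measure_union_null
    -- `C` and `D` are arbitrary sets here, so only the inequality valid without measurability is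
    -- available; it suffices.
    (nonpos_iff_eq_zero.1 ((Measure.le_map_apply hF.aemeasurable C).trans (hC _ hFμ).le))
    (nonpos_iff_eq_zero.1 ((Measure.le_map_apply hF.aemeasurable D).trans (hD _ hFμ).le)))
  rintro _ (⟨X, hX, rfl⟩ | ⟨X, hX, rfl⟩)
  · exact Or.inl hX
  · exact Or.inr hX

/-! ### Degrees of tt-deep classes -/

theorem exists_ttDeep : ∃ C : Pi01Class, TTDeep C.carrier := by
  have h : IsPi01 (∅ : Set Cantor) := by
    convert isPi01_of_tree (t := fun _ => false) (Computable.const false) using 1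
    ext X
    simp
  exact ⟨⟨∅, h⟩, h.ttDeep fun μ _ => measure_empty⟩

/-- Both degree lattices are handled at once: all that matters about the order is that it implies
Muchnik reducibility. -/
theorem isLatticeFilter_degrees {L : Type*} [Lattice L] {deg : Pi01Class → L}
    (hsurj : Function.Surjective deg) (hle : ∀ C D, deg C ≤ deg D → MuchnikLE C D)
    (hinf : ∀ C D, deg C ⊓ deg D = deg (C.inf D)) :
    IsLatticeFilter {d | ∃ C : Pi01Class, TTDeep C.carrier ∧ deg C = d} := by
  refine ⟨?_, ?_, ?_⟩
  · obtain ⟨C, hC⟩ := exists_ttDeep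
    exact ⟨_, C, hC, rfl⟩
  · rintro _ y ⟨C, hC, rfl⟩ h
    obtain ⟨D, rfl⟩ := hsurj y
    exact ⟨D, D.isPi01.ttDeep ((hle C D h).ttNegligible hC.ttNegligible), rfl⟩
  · rintro _ _ ⟨C, hC, rfl⟩ ⟨D, hD, rfl⟩
    exact ⟨C.inf D, (C.inf D).isPi01.ttDeep (hC.ttNegligible.infSet hD.ttNegligible),
      (hinf C D).symm⟩

theorem ttDeep_congr {L : Type*} [Lattice L] {deg : Pi01Class → L}
    (hle : ∀ C D, deg C ≤ deg D → MuchnikLE C D) {C D : Pi01Class} (h : deg C = deg D) :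
    TTDeep C.carrier ↔ TTDeep D.carrier := by
  rw [C.isPi01.ttDeep_iff, D.isPi01.ttDeep_iff]
  exact ⟨(hle C D h.le).ttNegligible, (hle D C h.ge).ttNegligible⟩

end MassProblems

theorem mainTheorem5 :
    -- for `Π⁰₁` classes, tt-depth and tt-negligibility coincide
    (∀ C : MassProblems.Pi01Class,
      MassProblems.TTDeep C.carrier ↔ MassProblems.TTNegligible C.carrier) ∧
    -- tt-depth is an invariant of the Medvedev degree
    (∀ C D : MassProblems.Pi01Class, MassProblems.medvedevDeg C = MassProblems.medvedevDeg D →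
      (MassProblems.TTDeep C.carrier ↔ MassProblems.TTDeep D.carrier)) ∧
    -- the Medvedev degrees of tt-deep classes form a filter
    MassProblems.IsLatticeFilter
      {d : MassProblems.MedvedevDegree | ∃ C : MassProblems.Pi01Class,
        MassProblems.TTDeep C.carrier ∧ MassProblems.medvedevDeg C = d} ∧
    -- tt-depth is an invariant of the Muchnik degree
    (∀ C D : MassProblems.Pi01Class, MassProblems.muchnikDeg C = MassProblems.muchnikDeg D →
      (MassProblems.TTDeep C.carrier ↔ MassProblems.TTDeep D.carrier)) ∧
    -- the Muchnik degrees of tt-deep classes form a filter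
    MassProblems.IsLatticeFilter
      {d : MassProblems.MuchnikDegree | ∃ C : MassProblems.Pi01Class,
        MassProblems.TTDeep C.carrier ∧ MassProblems.muchnikDeg C = d} := by
  open MassProblems in
  exact ⟨fun C => C.isPi01.ttDeep_iff,
    fun C D h => ttDeep_congr (fun _ _ h => MedvedevLE.muchnikLE h) h,
    isLatticeFilter_degrees (fun d => Quotient.exists_rep d)
      (fun _ _ h => MedvedevLE.muchnikLE h) medvedevDeg_inf,
    fun C D h => ttDeep_congr (fun _ _ h => h) h,
    isLatticeFilter_degrees (fun d => Quotient.exists_rep d) (fun _ _ h => h) muchnikDeg_inf⟩
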